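/- Let $(M,\varphi,g)$ be an anti-paraKähler manifold, i.e. $M$ is a smooth manifold, $g$ a smooth Riemannian metric on $M$ with Levi-Civita connection $\nabla$, and $\varphi$ a smooth $(1,1)$-tensor field with $\varphi^2=\mathrm{id}$ whose eigenbundles for the eigenvalues $+1$ and $-1$ have the same rank, such that $g(\varphi X,\varphi Y)=g(X,Y)$ for all vector fields $X,Y$ and $\nabla\varphi=0$. Let $\delta\in\mathbb R$ and let $g_{BS}$ be the Berger type deformed Sasaki metric on the tangent bundle $\pi:TM\to M$, given at $u\in TM$ in terms of the horizontal lifts ${}^HX$ (with respect to $\nabla$) and the vertical lifts ${}^VX$ by $$g_{BS}({}^HX,{}^HY)=g(X,Y),\qquad g_{BS}({}^VX,{}^HY)=0,\qquad g_{BS}({}^VX,{}^VY)=g(X,Y)+\delta^2 g(X,\varphi u)\,g(Y,\varphi u).$$ For a smooth map $f$ between Riemannian manifolds, with local components $f^\gamma$, let $\beta(f)$ denote its second fundamental form, $$\beta(f)\Big(\frac{\partial}{\partial x^i},\frac{\partial}{\partial x^j}\Big)^{\gamma}=\frac{\partial^2 f^\gamma}{\partial x^i\partial x^j}-\Gamma^k_{ij}\frac{\partial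 f^\gamma}{\partial x^k}+\bar\Gamma^\gamma_{\alpha\beta}\frac{\partial f^\alpha}{\partial x^i}\frac{\partial f^\beta}{\partial x^j},$$ where $\Gamma^k_{ij}$ and $\bar\Gamma^\gamma_{\alpha\beta}$ are the Christoffel symbols of the Levi-Civita connections of the source and of the target; $f$ is totally geodesic if $\beta(f)=0$, and harmonic if its tension field $\tau(f)$, the trace of $\beta(f)$ with respect to the metric of the source, vanishes. Then $g_{BS}$ is a smooth Riemannian metric on $TM$, and $\pi:(TM,g_{BS})\to(M,g)$ is a Riemannian submersion. It is totally geodesic if and only if $\nabla$ is locally flat, i.e. its curvature tensor vanishes identically. Moreover, $\pi$ is a harmonic map. -/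

import Mathlib

open scoped Manifold ContDiff

set_option maxSynthPendingDepth 3

noncomputable section

namespace BergerSasaki

/-! ### Levi-Civita connection and curvature on an open subset of a vector space -/

section Local

variable {V : Type*} [NormedAddCommGroup V] [NormedSpace ℝ V]

/-- Christoffel symbols of the second kind of a field of bilinear forms `G` on a vector space,
as the bilinear map `Γ_y(a, b) = Γ^k_{ij} a^i b^j ∂_k`, where
`G_y(Γ_y(a, b), c) = (1/2) (∂_a G(b, c) + ∂_b G(a, c) - ∂_c G(a, b))`.
The index is raised with the inverse of `G_y : V → V*`. -/
def christoffel (G : V → V →L[ℝ] V →L[ℝ] ℝ) (y : V) : V →L[ℝ] V →L[ℝ] V :=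
  let D : V →L[ℝ] V →L[ℝ] V →L[ℝ] ℝ := fderiv ℝ G y
  let D' : V →L[ℝ] V →L[ℝ] V →L[ℝ] ℝ :=
    (ContinuousLinearMap.flipₗᵢ ℝ V V ℝ : (V →L[ℝ] V →L[ℝ] ℝ) →L[ℝ] (V →L[ℝ] V →L[ℝ] ℝ)) ∘L D.flip
  let L : V →L[ℝ] V →L[ℝ] V →L[ℝ] ℝ := (1 / 2 : ℝ) • (D + D.flip - D')
  (ContinuousLinearMap.compL ℝ V (V →L[ℝ] ℝ) V (G y).inverse) ∘L L

/-- The defining formula of `christoffel`, written out. -/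
lemma christoffel_apply (G : V → V →L[ℝ] V →L[ℝ] ℝ) (y a b : V) :
    ∃ ℓ : V →L[ℝ] ℝ, christoffel G y a b = (G y).inverse ℓ ∧
      ∀ c, ℓ c = (1 / 2 : ℝ) *
        (fderiv ℝ G y a b c + fderiv ℝ G y b a c - fderiv ℝ G y c a b) :=
  ⟨_, rfl, fun _ => rfl⟩

/-- The curvature `R_y(a, b) c = ∇_a ∇_b c - ∇_b ∇_a c` of the connection with Christoffel symbols
`christoffel G`, for constant (coordinate) fields `a`, `b`, `c`. -/
def curvatureLocal (G : V → V →L[ℝ] V →L[ℝ] ℝ) (y a b c : V) : V :=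
  fderiv ℝ (christoffel G) y a b c - fderiv ℝ (christoffel G) y b a c
    + christoffel G y a (christoffel G y b c) - christoffel G y b (christoffel G y a c)

end Local

/-! ### Tensors on manifolds, read in charts

The tangent space `TangentSpace I p` is the model space `E`, through the preferred chart at `p`.
So a tensor at `p` is computed in the preferred chart at `p`. All manifolds are without boundary. -/

section Manifold

variable {E : Type*} [NormedAddCommGroup E] [NormedSpace ℝ E]
  {H : Type*} [TopologicalSpace H] (I : ModelWithCorners ℝ E H)
  {M : Type*} [TopologicalSpace M] [ChartedSpace H M]
  {E' : Type*} [NormedAddCommGroup E'] [NormedSpace ℝ E']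
  {H' : Type*} [TopologicalSpace H'] (I' : ModelWithCorners ℝ E' H')
  {N : Type*} [TopologicalSpace N] [ChartedSpace H' N]

/-- The components of a field `h` of bilinear forms on the tangent spaces in the preferred chart
at `p`: the pullback of `h` by the inverse of the chart. -/
def metricInChart (h : ∀ q : M, TangentSpace I q →L[ℝ] TangentSpace I q →L[ℝ] ℝ) (p : M) (y : E) :
    E →L[ℝ] E →L[ℝ] ℝ :=
  let hq : E →L[ℝ] E →L[ℝ] ℝ := h ((extChartAt I p).symm y)
  let e : E →L[ℝ] E := mfderiv 𝓘(ℝ, E) I (extChartAt I p).symm y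
  hq.bilinearComp e e

/-- The components of a field `φ` of endomorphisms in the preferred chart at `p`. -/
def endoInChart (φ : ∀ q : M, TangentSpace I q →L[ℝ] TangentSpace I q) (p : M) (y : E) :
    E →L[ℝ] E :=
  (mfderiv I 𝓘(ℝ, E) (extChartAt I p) ((extChartAt I p).symm y)) ∘L
    (φ ((extChartAt I p).symm y)) ∘L (mfderiv 𝓘(ℝ, E) I (extChartAt I p).symm y)

/-- The Christoffel symbols of `h` at `p` in the preferred chart at `p`. -/
def christoffelAt (h : ∀ q : M, TangentSpace I q →L[ℝ] TangentSpace I q →L[ℝ] ℝ) (p : M) :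
    TangentSpace I p →L[ℝ] TangentSpace I p →L[ℝ] TangentSpace I p :=
  christoffel (V := E) (metricInChart I h p) (extChartAt I p p)

/-- The curvature tensor `R(a, b) c` at `p` of the Levi-Civita connection of `h`. -/
def curvature (h : ∀ q : M, TangentSpace I q →L[ℝ] TangentSpace I q →L[ℝ] ℝ) (p : M)
    (a b c : TangentSpace I p) : TangentSpace I p :=
  curvatureLocal (V := E) (metricInChart I h p) (extChartAt I p p) a b c

/-- The Levi-Civita connection of `h` is locally flat: its curvature tensor vanishes. -/
def IsLocallyFlat (h : ∀ q : M, TangentSpace I q →L[ℝ] TangentSpace I q →L[ℝ] ℝ) : Prop :=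
  ∀ (p : M) (a b c : TangentSpace I p), curvature I h p a b c = 0

/-- The covariant derivative `(∇_a φ) b` at `p` of a field of endomorphisms, for the Levi-Civita
connection of `h`: in components `a^k b^j (∂_k φ^i_j + Γ^i_{kl} φ^l_j - φ^i_l Γ^l_{kj})`. -/
def covDerivEndo (h : ∀ q : M, TangentSpace I q →L[ℝ] TangentSpace I q →L[ℝ] ℝ)
    (φ : ∀ q : M, TangentSpace I q →L[ℝ] TangentSpace I q) (p : M)
    (a b : TangentSpace I p) : TangentSpace I p :=
  let dφ : E →L[ℝ] E →L[ℝ] E := fderiv ℝ (endoInChart I φ p) (extChartAt I p p)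
  let Γ : E →L[ℝ] E →L[ℝ] E := christoffelAt I h p
  let φp : E →L[ℝ] E := φ p
  (dφ a b + Γ a (φp b) - φp (Γ a b) : E)

/-- The second fundamental form `β(f)_p(a, b)` of a map `f : (M, h) → (N, h')`: in components
`a^i b^j (∂_i ∂_j f^γ - Γ^k_{ij} ∂_k f^γ + Γ'^γ_{αβ} ∂_i f^α ∂_j f^β)`. -/
def secondFundamentalForm (h : ∀ q : M, TangentSpace I q →L[ℝ] TangentSpace I q →L[ℝ] ℝ)
    (h' : ∀ q : N, TangentSpace I' q →L[ℝ] TangentSpace I' q →L[ℝ] ℝ) (f : M → N) (p : M)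
    (a b : TangentSpace I p) : TangentSpace I' (f p) :=
  let F : E → E' := writtenInExtChartAt I I' p f
  let y : E := extChartAt I p p
  let dF : TangentSpace I p →L[ℝ] TangentSpace I' (f p) := fderiv ℝ F y
  let d2F : TangentSpace I p →L[ℝ] TangentSpace I p →L[ℝ] TangentSpace I' (f p) :=
    fderiv ℝ (fderiv ℝ F) y
  d2F a b - dF (christoffelAt I h p a b) + christoffelAt I' h' (f p) (dF a) (dF b)

/-- The tension field `τ(f)_p`, the trace of the second fundamental form:
`h^{ij} β(f)_p(e_i, e_j)` for a basis `e` of the tangent space at `p`. -/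
def tensionField [FiniteDimensional ℝ E]
    (h : ∀ q : M, TangentSpace I q →L[ℝ] TangentSpace I q →L[ℝ] ℝ)
    (h' : ∀ q : N, TangentSpace I' q →L[ℝ] TangentSpace I' q →L[ℝ] ℝ) (f : M → N) (p : M) :
    TangentSpace I' (f p) :=
  let e := Module.finBasis ℝ E
  let G : E →L[ℝ] E →L[ℝ] ℝ := h p
  ∑ i, ∑ j, e.coord i (G.inverse (LinearMap.toContinuousLinearMap (e.coord j))) •
    secondFundamentalForm I I' h h' f p (e i) (e j)

/-- `f : (M, h) → (N, h')` is totally geodesic: its second fundamental form vanishes. -/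
def IsTotallyGeodesic (h : ∀ q : M, TangentSpace I q →L[ℝ] TangentSpace I q →L[ℝ] ℝ)
    (h' : ∀ q : N, TangentSpace I' q →L[ℝ] TangentSpace I' q →L[ℝ] ℝ) (f : M → N) : Prop :=
  ContMDiff I I' ∞ f ∧
    ∀ (p : M) (a b : TangentSpace I p), secondFundamentalForm I I' h h' f p a b = 0

/-- `f : (M, h) → (N, h')` is harmonic: its tension field vanishes. -/
def IsHarmonic [FiniteDimensional ℝ E]
    (h : ∀ q : M, TangentSpace I q →L[ℝ] TangentSpace I q →L[ℝ] ℝ)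
    (h' : ∀ q : N, TangentSpace I' q →L[ℝ] TangentSpace I' q →L[ℝ] ℝ) (f : M → N) : Prop :=
  ContMDiff I I' ∞ f ∧ ∀ p : M, tensionField I I' h h' f p = 0

/-- `f : (M, h) → (N, h')` is a Riemannian submersion: a smooth surjective submersion whose
differential is isometric on the orthogonal complement of its kernel. -/
structure IsRiemannianSubmersion
    (h : ∀ q : M, TangentSpace I q →L[ℝ] TangentSpace I q →L[ℝ] ℝ)
    (h' : ∀ q : N, TangentSpace I' q →L[ℝ] TangentSpace I' q →L[ℝ] ℝ) (f : M → N) : Prop where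
  contMDiff : ContMDiff I I' ∞ f
  surjective : Function.Surjective f
  surjective_mfderiv (p : M) : Function.Surjective (mfderiv I I' f p)
  isometric (p : M) (a b : TangentSpace I p)
    (ha : ∀ c, mfderiv I I' f p c = 0 → h p a c = 0)
    (hb : ∀ c, mfderiv I I' f p c = 0 → h p b c = 0) :
    h' (f p) (mfderiv I I' f p a) (mfderiv I I' f p b) = h p a b

/-! ### Anti-paraKähler manifolds -/

variable [IsManifold I ∞ M]

/-- `φ` is an almost paracomplex structure: a smooth field of endomorphisms with `φ² = id` whose
eigenbundles for `1` and `-1` have the same rank. -/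
structure IsAlmostParacomplex (φ : ∀ q : M, TangentSpace I q →L[ℝ] TangentSpace I q) : Prop where
  contMDiff : ContMDiff I (I.prod 𝓘(ℝ, E →L[ℝ] E)) ∞
    (fun q ↦ Bundle.TotalSpace.mk' (E →L[ℝ] E) (E := fun q : M ↦ TangentSpace I q →L[ℝ] TangentSpace I q)
      q (φ q))
  sq_eq_id (q : M) (a : TangentSpace I q) : φ q (φ q a) = a
  rank_eq (q : M) :
    Module.finrank ℝ (Module.End.eigenspace (φ q : TangentSpace I q →ₗ[ℝ] TangentSpace I q) 1) =
    Module.finrank ℝ (Module.End.eigenspace (φ q : TangentSpace I q →ₗ[ℝ] TangentSpace I q) (-1))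

/-- `(M, φ, g)` is an almost anti-paraHermitian manifold. -/
structure IsAlmostAntiParaHermitian (g : Bundle.ContMDiffRiemannianMetric I ∞ E (TangentSpace I : M → Type _))
    (φ : ∀ q : M, TangentSpace I q →L[ℝ] TangentSpace I q) : Prop
    extends IsAlmostParacomplex I φ where
  metric_comp (q : M) (a b : TangentSpace I q) : g.inner q (φ q a) (φ q b) = g.inner q a b

/-- `(M, φ, g)` is an anti-paraKähler manifold: moreover `∇φ = 0`. -/
structure IsAntiParaKahler (g : Bundle.ContMDiffRiemannianMetric I ∞ E (TangentSpace I : M → Type _))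
    (φ : ∀ q : M, TangentSpace I q →L[ℝ] TangentSpace I q) : Prop
    extends IsAlmostAntiParaHermitian I g φ where
  parallel (q : M) (a b : TangentSpace I q) : covDerivEndo I g.inner φ q a b = 0

/-! ### The tangent bundle

The preferred chart of `TM` at `v` is induced by the preferred chart `(x^i)` of `M` at `π v`; its
coordinates are `(x^i, u^i)`. So `T_v(TM)` is `E × E`, with coordinates `(dx^i, du^i)`, and the
`u`-coordinates of `v` itself are `v.2`. -/

/-- The vertical lift `X^i ∂/∂u^i` of `X` to `v`. -/
def verticalLift (v : TangentBundle I M) (X : TangentSpace I v.proj) : TangentSpace I.tangent v :=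
  ((0, X) : E × E)

/-- The horizontal lift `X^i (∂/∂x^i - Γ^h_{ij} u^j ∂/∂u^h)` of `X` to `v`. -/
def horizontalLift (h : ∀ q : M, TangentSpace I q →L[ℝ] TangentSpace I q →L[ℝ] ℝ)
    (v : TangentBundle I M) (X : TangentSpace I v.proj) : TangentSpace I.tangent v :=
  ((X, -(christoffelAt I h v.proj X v.2 : E)) : E × E)

/-- The connection map `T_v(TM) → T_{π v} M`, with components `δu^i = du^i + Γ^i_{hj} u^j dx^h`. -/
def connectionMap (h : ∀ q : M, TangentSpace I q →L[ℝ] TangentSpace I q →L[ℝ] ℝ)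
    (v : TangentBundle I M) : TangentSpace I.tangent v →L[ℝ] TangentSpace I v.proj :=
  let Γ : E →L[ℝ] E →L[ℝ] E := christoffelAt I h v.proj
  let u : E := v.2
  (ContinuousLinearMap.snd ℝ E E + Γ.flip u ∘L ContinuousLinearMap.fst ℝ E E : E × E →L[ℝ] E)

/-- The Berger type deformed Sasaki metric: horizontal and vertical vectors are orthogonal, it is
`g` on horizontal lifts and `g(X, Y) + δ² g(X, φ u) g(Y, φ u)` on vertical lifts at `u`
(see `bergerSasaki_horizontal`, `bergerSasaki_mixed`, `bergerSasaki_vertical`). -/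
def bergerSasaki (g : Bundle.ContMDiffRiemannianMetric I ∞ E (TangentSpace I : M → Type _))
    (φ : ∀ q : M, TangentSpace I q →L[ℝ] TangentSpace I q) (δ : ℝ) (v : TangentBundle I M) :
    TangentSpace I.tangent v →L[ℝ] TangentSpace I.tangent v →L[ℝ] ℝ :=
  let gq : E →L[ℝ] E →L[ℝ] ℝ := g.inner v.proj
  let dπ : E × E →L[ℝ] E := mfderiv I.tangent I (Bundle.TotalSpace.proj : TangentBundle I M → M) v
  let K : E × E →L[ℝ] E := connectionMap I g.inner v
  let θ : E × E →L[ℝ] ℝ := gq (φ v.proj v.2) ∘L K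
  (gq.bilinearComp dπ dπ + gq.bilinearComp K K + δ ^ 2 • θ.smulRight θ :
    E × E →L[ℝ] E × E →L[ℝ] ℝ)

lemma mfderiv_proj_apply (v : TangentBundle I M) (A : TangentSpace I.tangent v) :
    mfderiv I.tangent I (Bundle.TotalSpace.proj : TangentBundle I M → M) v A = (A : E × E).1 := by
  have hd : MDifferentiableAt I.tangent I (Bundle.TotalSpace.proj : TangentBundle I M → M) v :=
    (Bundle.contMDiff_proj (n := 1) (IB := I) (TangentSpace I : M → Type _)).mdifferentiableAt
      one_ne_zero
  have hw : writtenInExtChartAt I.tangent I v (Bundle.TotalSpace.proj : TangentBundle I M → M)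
      =ᶠ[nhdsWithin (extChartAt I.tangent v v) (Set.range I.tangent)]
        (Prod.fst : E × E → E) := by
    filter_upwards [extChartAt_target_mem_nhdsWithin (I := I.tangent) v] with y hy
    have h1 : y.1 ∈ (extChartAt I v.proj).target := by
      have := hy
      rw [FiberBundle.extChartAt_target] at this
      exact this.1.1
    have h2 : ((extChartAt I.tangent v).symm y).proj = (extChartAt I v.proj).symm y.1 := by
      have hy' : I.tangent.symm y ∈ (chartAt (ModelProd H E) v).target := by
        rw [extChartAt_target] at hy
        exact hy.1
      exact FiberBundle.chartedSpace_chartAt_symm_fst (HB := H) v _ hy'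
    show extChartAt I v.proj ((extChartAt I.tangent v).symm y).proj = y.1
    rw [h2, (extChartAt I v.proj).right_inv h1]
  have hu : UniqueDiffWithinAt ℝ (Set.range I.tangent) (extChartAt I.tangent v v) :=
    I.tangent.uniqueDiffOn.uniqueDiffWithinAt (Set.mem_range_self _)
  have he : (mfderiv I.tangent I (Bundle.TotalSpace.proj : TangentBundle I M → M) v :
      E × E →L[ℝ] E) = ContinuousLinearMap.fst ℝ E E :=
    hd.mfderiv.trans ((hw.fderivWithin_eq_of_mem (extChartAt_target_subset_range v
      (mem_extChartAt_target v))).trans (fderivWithin_fst hu))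
  exact congrArg (fun L : E × E →L[ℝ] E => L A) he

lemma bergerSasaki_apply (g : Bundle.ContMDiffRiemannianMetric I ∞ E (TangentSpace I : M → Type _))
    (φ : ∀ q : M, TangentSpace I q →L[ℝ] TangentSpace I q) (δ : ℝ) (v : TangentBundle I M)
    (A B : TangentSpace I.tangent v) :
    bergerSasaki I g φ δ v A B =
      g.inner v.proj (A : E × E).1 (B : E × E).1 +
        g.inner v.proj (connectionMap I g.inner v A) (connectionMap I g.inner v B) +
        δ ^ 2 * (g.inner v.proj (φ v.proj v.2) (connectionMap I g.inner v A) *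
          g.inner v.proj (φ v.proj v.2) (connectionMap I g.inner v B)) := by
  rw [← mfderiv_proj_apply I v A, ← mfderiv_proj_apply I v B]
  rfl

lemma connectionMap_horizontalLift
    (h : ∀ q : M, TangentSpace I q →L[ℝ] TangentSpace I q →L[ℝ] ℝ)
    (v : TangentBundle I M) (X : TangentSpace I v.proj) :
    connectionMap I h v (horizontalLift I h v X) = 0 :=
  neg_add_cancel (christoffelAt I h v.proj X v.2 : E)

lemma connectionMap_verticalLift
    (h : ∀ q : M, TangentSpace I q →L[ℝ] TangentSpace I q →L[ℝ] ℝ)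
    (v : TangentBundle I M) (X : TangentSpace I v.proj) :
    connectionMap I h v (verticalLift I v X) = X := by
  have h1 : ∀ (Γ : E →L[ℝ] E →L[ℝ] E) (u w : E), w + Γ 0 u = w := fun Γ u w => by simp
  exact h1 (christoffelAt I h v.proj) v.2 X

lemma bergerSasaki_horizontal (g : Bundle.ContMDiffRiemannianMetric I ∞ E (TangentSpace I : M → Type _))
    (φ : ∀ q : M, TangentSpace I q →L[ℝ] TangentSpace I q) (δ : ℝ) (v : TangentBundle I M)
    (X Y : TangentSpace I v.proj) :
    bergerSasaki I g φ δ v (horizontalLift I g.inner v X) (horizontalLift I g.inner v Y) =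
      g.inner v.proj X Y := by
  rw [bergerSasaki_apply, connectionMap_horizontalLift, connectionMap_horizontalLift]
  simp [horizontalLift]

lemma bergerSasaki_mixed (g : Bundle.ContMDiffRiemannianMetric I ∞ E (TangentSpace I : M → Type _))
    (φ : ∀ q : M, TangentSpace I q →L[ℝ] TangentSpace I q) (δ : ℝ) (v : TangentBundle I M)
    (X Y : TangentSpace I v.proj) :
    bergerSasaki I g φ δ v (verticalLift I v X) (horizontalLift I g.inner v Y) = 0 ∧
      bergerSasaki I g φ δ v (horizontalLift I g.inner v X) (verticalLift I v Y) = 0 := by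
  have h0 : ∀ Z : TangentSpace I v.proj, g.inner v.proj Z (0 : E) = 0 := fun Z => map_zero _
  have h0' : ∀ Z : TangentSpace I v.proj, g.inner v.proj (0 : E) Z = 0 := fun Z =>
    (g.symm _ _ _).trans (h0 Z)
  constructor <;> rw [bergerSasaki_apply, connectionMap_horizontalLift,
    connectionMap_verticalLift] <;> simp [horizontalLift, verticalLift, h0, h0']

lemma bergerSasaki_vertical (g : Bundle.ContMDiffRiemannianMetric I ∞ E (TangentSpace I : M → Type _))
    (φ : ∀ q : M, TangentSpace I q →L[ℝ] TangentSpace I q) (δ : ℝ) (v : TangentBundle I M)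
    (X Y : TangentSpace I v.proj) :
    bergerSasaki I g φ δ v (verticalLift I v X) (verticalLift I v Y) =
      g.inner v.proj X Y +
        δ ^ 2 * g.inner v.proj X (φ v.proj v.2) * g.inner v.proj Y (φ v.proj v.2) := by
  have h0 : g.inner v.proj (0 : E) (0 : E) = 0 := map_zero _
  rw [bergerSasaki_apply, connectionMap_verticalLift, connectionMap_verticalLift,
    g.symm _ X (φ v.proj v.2), g.symm _ Y (φ v.proj v.2)]
  simp only [verticalLift, h0]
  ring

end Manifold

end BergerSasaki

end

/-!
In induced coordinates `z = (x, u)` of the tangent bundle, let `K` be the connection map and `h` the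
deformed metric on the fibres. Since the curvature `R` of `g` is the bracket of horizontal lifts,
Koszul's formula for `g_BS` with a horizontal test vector over `c` gives
`g(β(A, B), c) = -½ (h(K B, R(A, c) u) + h(K A, R(B, c) u))` for the second fundamental form `β` of
the projection. The other terms cancel because `h` is invariant under parallel transport, which is
where `∇φ = 0` enters. With `A` vertical and `B` horizontal this shows that `β = 0` forces `R = 0`.
The reflection in the horizontal distribution is an isometry of `g_BS` which fixes the base
component of a vector and changes the sign of `K`, so it changes the sign of `β`, whose trace
therefore vanishes.
-/

noncomputable section

namespace BergerSasaki

open Filter Topology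

section BilinearForms

variable {V : Type*} [NormedAddCommGroup V] [NormedSpace ℝ V]

lemma eq_of_forall_apply_eq {B : V →L[ℝ] V →L[ℝ] ℝ} (hB : B.IsInvertible) {v w : V}
    (h : ∀ c, B v c = B w c) : v = w :=
  hB.injective (ContinuousLinearMap.ext h)

lemma isInvertible_of_pos [FiniteDimensional ℝ V] {B : V →L[ℝ] V →L[ℝ] ℝ}
    (hB : ∀ v, v ≠ 0 → 0 < B v v) : B.IsInvertible := by
  have hinj : Function.Injective (B : V →ₗ[ℝ] V →L[ℝ] ℝ) := by
    refine (injective_iff_map_eq_zero _).2 fun v hv => by_contra fun hne => ?_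
    have hBv : B v = 0 := hv
    simpa [hBv] using hB v hne
  have hdim : Module.finrank ℝ V = Module.finrank ℝ (V →L[ℝ] ℝ) :=
    (Subspace.dual_finrank_eq (K := ℝ) (V := V)).symm.trans
      (LinearMap.toContinuousLinearMap (𝕜 := ℝ) (E := V) (F' := ℝ)).finrank_eq
  exact ⟨(LinearEquiv.ofInjectiveOfFinrankEq _ hinj hdim).toContinuousLinearEquiv, rfl⟩

lemma exists_pos_mul_norm_sq_le [FiniteDimensional ℝ V] {B : V →L[ℝ] V →L[ℝ] ℝ}
    (hB : ∀ v, v ≠ 0 → 0 < B v v) : ∃ m > 0, ∀ v, m * ‖v‖ ^ 2 ≤ B v v := by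
  rcases subsingleton_or_nontrivial V with hV | hV
  · exact ⟨1, one_pos, fun v => by simp [Subsingleton.elim v 0]⟩
  obtain ⟨x, hx, hmin⟩ := (isCompact_sphere (0 : V) 1).exists_isMinOn
    (NormedSpace.sphere_nonempty.2 zero_le_one)
    (show Continuous fun v : V => B v v by fun_prop).continuousOn
  refine ⟨B x x, hB x (ne_zero_of_mem_unit_sphere ⟨x, hx⟩), fun v => ?_⟩
  rcases eq_or_ne v 0 with rfl | hv
  · simp
  have hle : B x x ≤ B (‖v‖⁻¹ • v) (‖v‖⁻¹ • v) := hmin (by simp [norm_smul, hv])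
  simp only [map_smul, smul_apply, smul_eq_mul] at hle
  have : 0 < ‖v‖ := norm_pos_iff.2 hv
  calc B x x * ‖v‖ ^ 2 ≤ ‖v‖⁻¹ * (‖v‖⁻¹ * B v v) * ‖v‖ ^ 2 := by gcongr
    _ = B v v := by field_simp

lemma isVonNBounded_of_pos [FiniteDimensional ℝ V] {B : V →L[ℝ] V →L[ℝ] ℝ}
    (hB : ∀ v, v ≠ 0 → 0 < B v v) : Bornology.IsVonNBounded ℝ {v : V | B v v < 1} := by
  obtain ⟨m, hm, hle⟩ := exists_pos_mul_norm_sq_le hB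
  rw [NormedSpace.isVonNBounded_iff]
  refine (Metric.isBounded_closedBall (x := (0 : V)) (r := √m⁻¹)).subset fun v hv => ?_
  rw [mem_closedBall_zero_iff]
  refine Real.le_sqrt_of_sq_le ?_
  rw [← one_div, le_div_iff₀' hm]
  exact (hle v).trans (le_of_lt hv)

lemma apply_inverse_comp_involutive {B : V →L[ℝ] V →L[ℝ] ℝ} (hB : B.IsInvertible) {σ : V →L[ℝ] V}
    (hσ : Function.Involutive σ) (hiso : ∀ v w, B (σ v) (σ w) = B v w) (ℓ : V →L[ℝ] ℝ) :
    σ (B.inverse ℓ) = B.inverse (ℓ ∘L σ) := by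
  refine eq_of_forall_apply_eq hB fun w => ?_
  calc B (σ (B.inverse ℓ)) w = B (σ (B.inverse ℓ)) (σ (σ w)) := by rw [hσ w]
    _ = B (B.inverse (ℓ ∘L σ)) w := by
      rw [hiso, hB.self_apply_inverse, hB.self_apply_inverse, ContinuousLinearMap.comp_apply]

section Trace

variable {W : Type*} [NormedAddCommGroup W] [NormedSpace ℝ W] [FiniteDimensional ℝ V]
  {ι : Type*} [Fintype ι]

lemma sum_coord_inverse_smul (e : Module.Basis ι ℝ V) (B : V →L[ℝ] V →L[ℝ] ℝ)
    (β : V →L[ℝ] V →L[ℝ] W) :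
    ∑ i, ∑ j, e.coord i (B.inverse (LinearMap.toContinuousLinearMap (e.coord j))) • β (e i) (e j) =
      ∑ j, β (B.inverse (LinearMap.toContinuousLinearMap (e.coord j))) (e j) := by
  rw [Finset.sum_comm]
  refine Finset.sum_congr rfl fun j _ => ?_
  conv_rhs => rw [← e.sum_repr (B.inverse (LinearMap.toContinuousLinearMap (e.coord j)))]
  simp only [map_sum, map_smul, sum_apply, smul_apply, Module.Basis.coord_apply]

lemma sum_inverse_coord_involutive (e : Module.Basis ι ℝ V) {B : V →L[ℝ] V →L[ℝ] ℝ}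
    (hB : B.IsInvertible) {σ : V →L[ℝ] V} (hσ : Function.Involutive σ)
    (hiso : ∀ v w, B (σ v) (σ w) = B v w) (β : V →L[ℝ] V →L[ℝ] W) :
    ∑ j, β (σ (B.inverse (LinearMap.toContinuousLinearMap (e.coord j)))) (σ (e j)) =
      ∑ j, β (B.inverse (LinearMap.toContinuousLinearMap (e.coord j))) (e j) := by
  have hcoord (j : ι) : LinearMap.toContinuousLinearMap (e.coord j) ∘L σ =
      ∑ k, e.coord j (σ (e k)) • LinearMap.toContinuousLinearMap (e.coord k) := by
    ext v
    conv_lhs => rw [← e.sum_repr v]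
    simp only [map_sum, map_smul, ContinuousLinearMap.comp_apply,
      LinearMap.coe_toContinuousLinearMap', sum_apply, smul_apply, smul_eq_mul,
      Module.Basis.coord_apply, mul_comm]
  have hσe (k : ι) : ∑ j, e.coord j (σ (e k)) • σ (e j) = e k := by
    conv_rhs => rw [← hσ (e k), ← e.sum_repr (σ (e k))]
    simp only [map_sum, map_smul, Module.Basis.coord_apply]
  simp only [apply_inverse_comp_involutive hB hσ hiso, hcoord, map_sum, map_smul, sum_apply,
    smul_apply]
  rw [Finset.sum_comm]
  refine Finset.sum_congr rfl fun k _ => ?_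
  conv_rhs => rw [← hσe k]
  simp only [map_sum, map_smul]

lemma sum_coord_inverse_smul_eq_zero (e : Module.Basis ι ℝ V) {B : V →L[ℝ] V →L[ℝ] ℝ}
    (hB : B.IsInvertible) {σ : V →L[ℝ] V} (hσ : Function.Involutive σ)
    (hiso : ∀ v w, B (σ v) (σ w) = B v w) {β : V →L[ℝ] V →L[ℝ] W}
    (hβ : ∀ v w, β (σ v) (σ w) = -β v w) :
    ∑ i, ∑ j, e.coord i (B.inverse (LinearMap.toContinuousLinearMap (e.coord j))) •
      β (e i) (e j) = 0 := by
  have hinv := sum_inverse_coord_involutive e hB hσ hiso β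
  simp only [hβ, Finset.sum_neg_distrib] at hinv
  rw [sum_coord_inverse_smul]
  have : IsAddTorsionFree W := .of_isTorsionFree ℝ W
  exact self_eq_neg.1 hinv.symm

end Trace

end BilinearForms

section Pullback

variable {X U U' V V' W : Type*} [NormedAddCommGroup X] [NormedSpace ℝ X] [NormedAddCommGroup U]
  [NormedSpace ℝ U] [NormedAddCommGroup U'] [NormedSpace ℝ U'] [NormedAddCommGroup V]
  [NormedSpace ℝ V] [NormedAddCommGroup V'] [NormedSpace ℝ V'] [NormedAddCommGroup W]
  [NormedSpace ℝ W] {B : X → V →L[ℝ] V' →L[ℝ] W} {f : X → U →L[ℝ] V} {f' : X → U' →L[ℝ] V'}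
  {x : X}

lemma contDiffAt_bilinearComp {n : WithTop ℕ∞} (hB : ContDiffAt ℝ n B x) (hf : ContDiffAt ℝ n f x)
    (hf' : ContDiffAt ℝ n f' x) :
    ContDiffAt ℝ n (fun y => (B y).bilinearComp (f y) (f' y)) x :=
  have hflip := (ContinuousLinearMap.flipₗᵢ ℝ U V' W).contDiff.contDiffAt.comp x (hB.clm_comp hf)
  (ContinuousLinearMap.flipₗᵢ ℝ U' U W).contDiff.contDiffAt.comp x (hflip.clm_comp hf')

lemma differentiableAt_bilinearComp (hB : DifferentiableAt ℝ B x) (hf : DifferentiableAt ℝ f x)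
    (hf' : DifferentiableAt ℝ f' x) :
    DifferentiableAt ℝ (fun y => (B y).bilinearComp (f y) (f' y)) x :=
  have hflip := (ContinuousLinearMap.flipₗᵢ ℝ U V' W).differentiableAt.comp x (hB.clm_comp hf)
  (ContinuousLinearMap.flipₗᵢ ℝ U' U W).differentiableAt.comp x (hflip.clm_comp hf')

lemma fderiv_apply_apply (hf : DifferentiableAt ℝ f x) (a : X) (u : U) :
    fderiv ℝ f x a u = fderiv ℝ (fun y => f y u) x a := by
  simp [fderiv_clm_apply hf (differentiableAt_const u)]

lemma fderiv_apply_apply_apply (hB : DifferentiableAt ℝ B x) (a : X) (v : V) (v' : V') :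
    fderiv ℝ B x a v v' = fderiv ℝ (fun y => B y v v') x a := by
  rw [fderiv_apply_apply hB, fderiv_apply_apply (hB.clm_apply (differentiableAt_const v))]

lemma fderiv_bilinearComp_apply (hB : DifferentiableAt ℝ B x) (hf : DifferentiableAt ℝ f x)
    (hf' : DifferentiableAt ℝ f' x) (a : X) (u : U) (u' : U') :
    fderiv ℝ (fun y => (B y).bilinearComp (f y) (f' y)) x a u u' =
      fderiv ℝ B x a (f x u) (f' x u') + B x (fderiv ℝ f x a u) (f' x u') +
        B x (f x u) (fderiv ℝ f' x a u') := by
  have hBf := hB.hasFDerivAt.clm_apply (hf.hasFDerivAt.clm_apply (hasFDerivAt_const u x))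
  have hBff := hBf.clm_apply (hf'.hasFDerivAt.clm_apply (hasFDerivAt_const u' x))
  rw [fderiv_apply_apply_apply (differentiableAt_bilinearComp hB hf hf')]
  simp only [ContinuousLinearMap.bilinearComp_apply, hBff.fderiv]
  simp only [ContinuousLinearMap.comp_zero, zero_add, ContinuousLinearMap.flip_add, add_apply,
    ContinuousLinearMap.comp_apply, ContinuousLinearMap.flip_apply]
  abel

end Pullback

section LeviCivita

variable {V : Type*} [NormedAddCommGroup V] [NormedSpace ℝ V] {G : V → V →L[ℝ] V →L[ℝ] ℝ} {y : V}

lemma christoffel_congr {G' : V → V →L[ℝ] V →L[ℝ] ℝ} (h : G =ᶠ[𝓝 y] G') :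
    christoffel G y = christoffel G' y := by
  unfold christoffel
  rw [h.fderiv_eq, h.eq_of_nhds]

lemma christoffel_koszul (hG : (G y).IsInvertible) (a b c : V) :
    G y (christoffel G y a b) c = (1 / 2 : ℝ) *
      (fderiv ℝ G y a b c + fderiv ℝ G y b a c - fderiv ℝ G y c a b) := by
  obtain ⟨ℓ, hℓ, hℓ_apply⟩ := christoffel_apply G y a b
  rw [hℓ, hG.self_apply_inverse, hℓ_apply]

lemma fderiv_symm_of_eventually_symm (hd : DifferentiableAt ℝ G y)
    (hs : ∀ᶠ z in 𝓝 y, ∀ b c, G z b c = G z c b) (a b c : V) :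
    fderiv ℝ G y a b c = fderiv ℝ G y a c b := by
  have heq : (fun z => G z b c) =ᶠ[𝓝 y] fun z => G z c b := hs.mono fun z hz => hz b c
  rw [fderiv_apply_apply_apply hd, fderiv_apply_apply_apply hd, heq.fderiv_eq]

lemma fderiv_metric_eq (hG : (G y).IsInvertible) (hd : DifferentiableAt ℝ G y)
    (hs : ∀ᶠ z in 𝓝 y, ∀ b c, G z b c = G z c b) (a b c : V) :
    fderiv ℝ G y a b c = G y (christoffel G y a b) c + G y b (christoffel G y a c) := by
  rw [hs.self_of_nhds b, christoffel_koszul hG, christoffel_koszul hG,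
    fderiv_symm_of_eventually_symm hd hs b a c, fderiv_symm_of_eventually_symm hd hs c a b,
    fderiv_symm_of_eventually_symm hd hs a c b]
  ring

lemma contDiffAt_christoffel [CompleteSpace V] {m n : WithTop ℕ∞} (hG : (G y).IsInvertible)
    (hs : ContDiffAt ℝ n G y) (hmn : m + 1 ≤ n) : ContDiffAt ℝ m (christoffel G) y := by
  have hD : ContDiffAt ℝ m (fderiv ℝ G) y := hs.fderiv_right hmn
  have hflip : ContDiffAt ℝ m (fun z => (fderiv ℝ G z).flip) y :=
    (ContinuousLinearMap.flipₗᵢ ℝ V V (V →L[ℝ] ℝ)).contDiff.contDiffAt.comp y hD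
  have hinv : ContDiffAt ℝ m (fun z => (G z).inverse) y :=
    hG.contDiffAt_map_inverse.comp y (hs.of_le (le_self_add.trans hmn))
  have hcomp : ContDiffAt ℝ m
      (fun z => ContinuousLinearMap.compL ℝ V (V →L[ℝ] ℝ) V (G z).inverse) y :=
    (ContinuousLinearMap.compL ℝ V (V →L[ℝ] ℝ) V).contDiff.contDiffAt.comp y hinv
  exact hcomp.clm_comp
    (((hD.add hflip).sub (contDiffAt_const.clm_comp hflip)).const_smul (1 / 2 : ℝ))

variable {W : Type*} [NormedAddCommGroup W] [NormedSpace ℝ W] {G' : W → W →L[ℝ] W →L[ℝ] ℝ}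
  {κ : V → W}

lemma fderiv_pullback_apply (hd' : DifferentiableAt ℝ G' (κ y)) (hκ : ContDiffAt ℝ 2 κ y)
    (hpull : G =ᶠ[𝓝 y] fun z => (G' (κ z)).bilinearComp (fderiv ℝ κ z) (fderiv ℝ κ z)) (a b c : V) :
    fderiv ℝ G y a b c =
      fderiv ℝ G' (κ y) (fderiv ℝ κ y a) (fderiv ℝ κ y b) (fderiv ℝ κ y c) +
        G' (κ y) (fderiv ℝ (fderiv ℝ κ) y a b) (fderiv ℝ κ y c) +
        G' (κ y) (fderiv ℝ κ y b) (fderiv ℝ (fderiv ℝ κ) y a c) := by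
  have hκd : DifferentiableAt ℝ κ y := hκ.differentiableAt two_ne_zero
  have hDκ : DifferentiableAt ℝ (fderiv ℝ κ) y :=
    (hκ.fderiv_right (m := 1) one_add_one_eq_two.le).differentiableAt one_ne_zero
  rw [hpull.fderiv_eq,
    fderiv_bilinearComp_apply (B := fun z => G' (κ z)) (hd'.comp y hκd) hDκ hDκ,
    fderiv_fun_comp y hd' hκd, ContinuousLinearMap.comp_apply]

lemma fderiv_apply_christoffel (hG : (G y).IsInvertible) (hG' : (G' (κ y)).IsInvertible)
    (hd' : DifferentiableAt ℝ G' (κ y)) (hs' : ∀ b c, G' (κ y) b c = G' (κ y) c b)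
    (hκ : ContDiffAt ℝ 2 κ y) (hsurj : Function.Surjective (fderiv ℝ κ y))
    (hpull : G =ᶠ[𝓝 y] fun z => (G' (κ z)).bilinearComp (fderiv ℝ κ z) (fderiv ℝ κ z)) (a b : V) :
    fderiv ℝ κ y (christoffel G y a b) =
      fderiv ℝ (fderiv ℝ κ) y a b + christoffel G' (κ y) (fderiv ℝ κ y a) (fderiv ℝ κ y b) := by
  have hsymm := hκ.isSymmSndFDerivAt (by simp)
  refine eq_of_forall_apply_eq hG' fun c' => ?_
  obtain ⟨c, rfl⟩ := hsurj c'
  have hy : G' (κ y) (fderiv ℝ κ y (christoffel G y a b)) (fderiv ℝ κ y c) =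
      G y (christoffel G y a b) c := by
    rw [hpull.self_of_nhds, ContinuousLinearMap.bilinearComp_apply]
  rw [hy, christoffel_koszul hG, map_add, add_apply, christoffel_koszul hG',
    fderiv_pullback_apply hd' hκ hpull, fderiv_pullback_apply hd' hκ hpull,
    fderiv_pullback_apply hd' hκ hpull, hsymm c a, hsymm c b, hsymm b a,
    hs' (fderiv ℝ κ y b), hs' (fderiv ℝ κ y a)]
  ring

end LeviCivita

section SasakiMetric

variable {V : Type*} [NormedAddCommGroup V] [NormedSpace ℝ V]

/-- The connection map `T(TM) → TM` of the Levi-Civita connection of `G` in the induced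
coordinates `z = (x, u)`, with components `δuⁱ = duⁱ + Γⁱₕⱼ uʲ dxʰ`. -/
def connectionMapLocal (G : V → V →L[ℝ] V →L[ℝ] ℝ) (z : V × V) : V × V →L[ℝ] V :=
  ContinuousLinearMap.snd ℝ V V + (christoffel G z.1).flip z.2 ∘L ContinuousLinearMap.fst ℝ V V

/-- The horizontal lift of the vector `c` to the point with induced coordinates `z = (x, u)`. -/
def horizontalLiftLocal (G : V → V →L[ℝ] V →L[ℝ] ℝ) (z : V × V) (c : V) : V × V :=
  (c, -christoffel G z.1 c z.2)

/-- The metric on the tangent bundle, in the induced coordinates, for which the horizontal and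
vertical distributions are orthogonal and which is `G` on horizontal vectors and a given field `h`
of bilinear forms on the fibres on vertical ones. The Sasaki metric is the case `h z = G z.1`. -/
def sasakiMetric (G : V → V →L[ℝ] V →L[ℝ] ℝ) (h : V × V → V →L[ℝ] V →L[ℝ] ℝ) (z : V × V) :
    V × V →L[ℝ] V × V →L[ℝ] ℝ :=
  (G z.1).bilinearComp (ContinuousLinearMap.fst ℝ V V) (ContinuousLinearMap.fst ℝ V V) +
    (h z).bilinearComp (connectionMapLocal G z) (connectionMapLocal G z)

/-- Invariance of a field `h` of bilinear forms on the fibres of the tangent bundle under parallel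
transport, at the point `z`: the derivative of `h` along horizontal lifts is the one prescribed by
the Levi-Civita connection of `G`. -/
def IsHorizontallyParallelAt (G : V → V →L[ℝ] V →L[ℝ] ℝ) (h : V × V → V →L[ℝ] V →L[ℝ] ℝ)
    (z : V × V) : Prop :=
  ∀ c k l, fderiv ℝ h z (horizontalLiftLocal G z c) k l =
    h z (christoffel G z.1 c k) l + h z k (christoffel G z.1 c l)

/-- The second fundamental form of the projection `(x, u) ↦ x` from the tangent bundle with metric
`S` to the base with metric `G`, in the induced coordinates. -/
def secondFundamentalFormFst (G : V → V →L[ℝ] V →L[ℝ] ℝ)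
    (S : V × V → V × V →L[ℝ] V × V →L[ℝ] ℝ) (z : V × V) : V × V →L[ℝ] V × V →L[ℝ] V :=
  (christoffel G z.1).bilinearComp (ContinuousLinearMap.fst ℝ V V) (ContinuousLinearMap.fst ℝ V V) -
    ContinuousLinearMap.compL ℝ (V × V) (V × V) V (ContinuousLinearMap.fst ℝ V V) ∘L christoffel S z

/-- The reflection in the horizontal subspace at `z`. -/
def horizontalReflection (G : V → V →L[ℝ] V →L[ℝ] ℝ) (z : V × V) : V × V →L[ℝ] V × V :=
  ContinuousLinearMap.id ℝ (V × V) -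
    ContinuousLinearMap.inr ℝ V V ∘L ((2 : ℝ) • connectionMapLocal G z)

variable (G : V → V →L[ℝ] V →L[ℝ] ℝ) (h : V × V → V →L[ℝ] V →L[ℝ] ℝ) (z : V × V)

lemma connectionMapLocal_apply (A : V × V) :
    connectionMapLocal G z A = A.2 + christoffel G z.1 A.1 z.2 := rfl

lemma connectionMapLocal_horizontalLiftLocal (c : V) :
    connectionMapLocal G z (horizontalLiftLocal G z c) = 0 :=
  neg_add_cancel (christoffel G z.1 c z.2)

lemma connectionMapLocal_zero_mk (k : V) : connectionMapLocal G z (0, k) = k := by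
  simp [connectionMapLocal_apply]

lemma sasakiMetric_apply (A B : V × V) :
    sasakiMetric G h z A B =
      G z.1 A.1 B.1 + h z (connectionMapLocal G z A) (connectionMapLocal G z B) := rfl

lemma secondFundamentalFormFst_apply (S : V × V → V × V →L[ℝ] V × V →L[ℝ] ℝ) (A B : V × V) :
    secondFundamentalFormFst G S z A B = christoffel G z.1 A.1 B.1 - (christoffel S z A B).1 := rfl

lemma horizontalReflection_apply (A : V × V) :
    horizontalReflection G z A = A - (0, (2 : ℝ) • connectionMapLocal G z A) := rfl

lemma fst_horizontalReflection (A : V × V) : (horizontalReflection G z A).1 = A.1 :=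
  sub_zero A.1

lemma connectionMapLocal_horizontalReflection (A : V × V) :
    connectionMapLocal G z (horizontalReflection G z A) = -connectionMapLocal G z A := by
  rw [horizontalReflection_apply, map_sub, connectionMapLocal_zero_mk, two_smul]
  abel

variable {G h z}

lemma eq_of_fst_eq_of_connectionMapLocal_eq {A B : V × V} (h₁ : A.1 = B.1)
    (h₂ : connectionMapLocal G z A = connectionMapLocal G z B) : A = B := by
  rw [connectionMapLocal_apply, connectionMapLocal_apply, h₁] at h₂
  exact Prod.ext h₁ (add_right_cancel h₂)

lemma horizontalReflection_involutive : Function.Involutive (horizontalReflection G z) := fun A =>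
  eq_of_fst_eq_of_connectionMapLocal_eq (G := G) (z := z)
    (by rw [fst_horizontalReflection, fst_horizontalReflection])
    (by rw [connectionMapLocal_horizontalReflection, connectionMapLocal_horizontalReflection,
      neg_neg])

lemma sasakiMetric_horizontalReflection (A B : V × V) :
    sasakiMetric G h z (horizontalReflection G z A) (horizontalReflection G z B) =
      sasakiMetric G h z A B := by
  simp only [sasakiMetric_apply, fst_horizontalReflection, connectionMapLocal_horizontalReflection,
    map_neg, neg_apply, neg_neg]

lemma sasakiMetric_symm (hG : ∀ b c, G z.1 b c = G z.1 c b) (hh : ∀ k l, h z k l = h z l k)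
    (A B : V × V) : sasakiMetric G h z A B = sasakiMetric G h z B A := by
  rw [sasakiMetric_apply, sasakiMetric_apply, hG, hh]

lemma sasakiMetric_pos (hG : ∀ v, v ≠ 0 → 0 < G z.1 v v) (hh : ∀ k, k ≠ 0 → 0 < h z k k)
    (A : V × V) (hA : A ≠ 0) : 0 < sasakiMetric G h z A A := by
  rw [sasakiMetric_apply]
  rcases eq_or_ne A.1 0 with h₁ | h₁
  · have hK : connectionMapLocal G z A ≠ 0 := fun hK =>
      hA (eq_of_fst_eq_of_connectionMapLocal_eq (G := G) (z := z) h₁ (by rw [hK, map_zero]))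
    simpa only [h₁, map_zero, zero_add] using hh _ hK
  · rcases eq_or_ne (connectionMapLocal G z A) 0 with hK | hK
    · simpa only [hK, map_zero, add_zero] using hG _ h₁
    · exact add_pos (hG _ h₁) (hh _ hK)

lemma contDiffAt_connectionMapLocal {n : WithTop ℕ∞} (hΓ : ContDiffAt ℝ n (christoffel G) z.1) :
    ContDiffAt ℝ n (connectionMapLocal G) z := by
  have hflip : ContDiffAt ℝ n (fun w : V × V => (christoffel G w.1).flip) z :=
    (ContinuousLinearMap.flipₗᵢ ℝ V V V).contDiff.contDiffAt.comp z (hΓ.comp z contDiffAt_fst)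
  exact contDiffAt_const.add ((hflip.clm_apply contDiffAt_snd).clm_comp contDiffAt_const)

lemma contDiffAt_sasakiMetric {n : WithTop ℕ∞} (hG : ContDiffAt ℝ n G z.1)
    (hΓ : ContDiffAt ℝ n (christoffel G) z.1) (hh : ContDiffAt ℝ n h z) :
    ContDiffAt ℝ n (sasakiMetric G h) z :=
  have hK := contDiffAt_connectionMapLocal hΓ
  (contDiffAt_bilinearComp (hG.comp z contDiffAt_fst) contDiffAt_const contDiffAt_const).add
    (contDiffAt_bilinearComp hh hK hK)

lemma differentiableAt_connectionMapLocal (hΓ : DifferentiableAt ℝ (christoffel G) z.1) :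
    DifferentiableAt ℝ (connectionMapLocal G) z := by
  have hflip : DifferentiableAt ℝ (fun w : V × V => (christoffel G w.1).flip) z :=
    (ContinuousLinearMap.flipₗᵢ ℝ V V V).differentiableAt.comp z (hΓ.comp z differentiableAt_fst)
  exact (differentiableAt_const _).add
    ((hflip.clm_apply differentiableAt_snd).clm_comp (differentiableAt_const _))

lemma fderiv_connectionMapLocal_apply (hΓ : DifferentiableAt ℝ (christoffel G) z.1) (A C : V × V) :
    fderiv ℝ (connectionMapLocal G) z A C =
      fderiv ℝ (christoffel G) z.1 A.1 C.1 z.2 + christoffel G z.1 C.1 A.2 := by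
  have hΓz : HasFDerivAt (fun w : V × V => christoffel G w.1)
      (fderiv ℝ (christoffel G) z.1 ∘L ContinuousLinearMap.fst ℝ V V) z :=
    hΓ.hasFDerivAt.comp z hasFDerivAt_fst
  have hK := ((hΓz.clm_apply (hasFDerivAt_const C.1 z)).clm_apply
    hasFDerivAt_snd).const_add C.2
  rw [fderiv_apply_apply (differentiableAt_connectionMapLocal hΓ)]
  simp only [connectionMapLocal_apply, hK.fderiv]
  simp [add_comm]

/-- The curvature measures the failure of the horizontal distribution to be integrable. -/
lemma fderiv_connectionMapLocal_sub (hΓ : DifferentiableAt ℝ (christoffel G) z.1) (A : V × V)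
    (c : V) :
    fderiv ℝ (connectionMapLocal G) z A (horizontalLiftLocal G z c) -
        fderiv ℝ (connectionMapLocal G) z (horizontalLiftLocal G z c) A =
      curvatureLocal G z.1 A.1 c z.2 + christoffel G z.1 c (connectionMapLocal G z A) := by
  simp only [fderiv_connectionMapLocal_apply hΓ, horizontalLiftLocal, curvatureLocal,
    connectionMapLocal_apply, map_add, map_neg]
  abel

lemma fderiv_sasakiMetric_apply (hG : DifferentiableAt ℝ G z.1)
    (hΓ : DifferentiableAt ℝ (christoffel G) z.1) (hh : DifferentiableAt ℝ h z) (A B C : V × V) :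
    fderiv ℝ (sasakiMetric G h) z A B C =
      fderiv ℝ G z.1 A.1 B.1 C.1 +
        fderiv ℝ h z A (connectionMapLocal G z B) (connectionMapLocal G z C) +
        h z (fderiv ℝ (connectionMapLocal G) z A B) (connectionMapLocal G z C) +
        h z (connectionMapLocal G z B) (fderiv ℝ (connectionMapLocal G) z A C) := by
  have hK := differentiableAt_connectionMapLocal hΓ
  have hG₁ : DifferentiableAt ℝ (fun w : V × V => G w.1) z := hG.comp z differentiableAt_fst
  have hfst := differentiableAt_const (𝕜 := ℝ) (x := z) (ContinuousLinearMap.fst ℝ V V)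
  have hbase := differentiableAt_bilinearComp hG₁ hfst hfst
  have hfibre := differentiableAt_bilinearComp hh hK hK
  unfold sasakiMetric
  rw [fderiv_fun_add hbase hfibre, add_apply, add_apply, add_apply,
    fderiv_bilinearComp_apply hG₁ hfst hfst, fderiv_bilinearComp_apply hh hK hK,
    fderiv_fun_comp z hG differentiableAt_fst]
  simp [add_assoc, fderiv_fst]

lemma curvatureLocal_zero_left (x b c : V) : curvatureLocal G x 0 b c = 0 := by
  simp [curvatureLocal]

variable (hGinv : (G z.1).IsInvertible)
    (hSinv : (sasakiMetric G h z).IsInvertible) (hG : DifferentiableAt ℝ G z.1)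
    (hΓ : DifferentiableAt ℝ (christoffel G) z.1) (hh : DifferentiableAt ℝ h z)
    (hsymm : ∀ k l, h z k l = h z l k) (hpar : IsHorizontallyParallelAt G h z)

include hGinv hSinv hG hΓ hh hsymm hpar

/-- Koszul's formula with a horizontal test vector, which only sees the base component. -/
lemma inner_fst_christoffel_sasakiMetric (A B : V × V) (c : V) :
    G z.1 (christoffel (sasakiMetric G h) z A B).1 c =
      G z.1 (christoffel G z.1 A.1 B.1) c + (1 / 2 : ℝ) *
        (h z (connectionMapLocal G z B) (curvatureLocal G z.1 A.1 c z.2) +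
          h z (connectionMapLocal G z A) (curvatureLocal G z.1 B.1 c z.2)) := by
  have hKC := connectionMapLocal_horizontalLiftLocal G z c
  have hcurv (A : V × V) : fderiv ℝ (connectionMapLocal G) z A (horizontalLiftLocal G z c) =
      curvatureLocal G z.1 A.1 c z.2 + christoffel G z.1 c (connectionMapLocal G z A) +
        fderiv ℝ (connectionMapLocal G) z (horizontalLiftLocal G z c) A :=
    sub_eq_iff_eq_add.1 (fderiv_connectionMapLocal_sub hΓ A c)
  have htest : G z.1 (christoffel (sasakiMetric G h) z A B).1 c =
      sasakiMetric G h z (christoffel (sasakiMetric G h) z A B) (horizontalLiftLocal G z c) := by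
    rw [sasakiMetric_apply, hKC, map_zero, add_zero, horizontalLiftLocal]
  rw [htest, christoffel_koszul hSinv, christoffel_koszul hGinv]
  simp only [fderiv_sasakiMetric_apply hG hΓ hh, hKC, hpar c, hcurv, map_zero, map_add]
  rw [hsymm (christoffel G z.1 c _), hsymm (fderiv ℝ (connectionMapLocal G) z
    (horizontalLiftLocal G z c) A)]
  simp only [horizontalLiftLocal]
  ring

lemma inner_secondFundamentalFormFst (A B : V × V) (c : V) :
    G z.1 (secondFundamentalFormFst G (sasakiMetric G h) z A B) c =
      -(1 / 2 : ℝ) * (h z (connectionMapLocal G z B) (curvatureLocal G z.1 A.1 c z.2) +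
        h z (connectionMapLocal G z A) (curvatureLocal G z.1 B.1 c z.2)) := by
  rw [secondFundamentalFormFst_apply, map_sub, sub_apply,
    inner_fst_christoffel_sasakiMetric hGinv hSinv hG hΓ hh hsymm hpar]
  ring

lemma secondFundamentalFormFst_eq_zero_iff (hinv : (h z).IsInvertible) :
    secondFundamentalFormFst G (sasakiMetric G h) z = 0 ↔
      ∀ b c, curvatureLocal G z.1 b c z.2 = 0 := by
  have hβ := inner_secondFundamentalFormFst hGinv hSinv hG hΓ hh hsymm hpar
  constructor
  · intro hzero b c
    refine eq_of_forall_apply_eq hinv fun k => ?_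
    have hk := hβ (0, k) (b, 0) c
    rw [hzero, connectionMapLocal_zero_mk, curvatureLocal_zero_left] at hk
    simpa [hsymm k] using hk
  · refine fun hR => ContinuousLinearMap.ext fun A => ContinuousLinearMap.ext fun B =>
      eq_of_forall_apply_eq hGinv fun c => ?_
    simp [hβ, hR]

lemma secondFundamentalFormFst_horizontalReflection (A B : V × V) :
    secondFundamentalFormFst G (sasakiMetric G h) z (horizontalReflection G z A)
        (horizontalReflection G z B) =
      -secondFundamentalFormFst G (sasakiMetric G h) z A B := by
  refine eq_of_forall_apply_eq hGinv fun c => ?_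
  simp only [map_neg, neg_apply, inner_secondFundamentalFormFst hGinv hSinv hG hΓ hh hsymm hpar,
    fst_horizontalReflection, connectionMapLocal_horizontalReflection]
  ring

lemma sum_secondFundamentalFormFst_eq_zero [FiniteDimensional ℝ V] {ι : Type*} [Fintype ι]
    (e : Module.Basis ι ℝ (V × V)) :
    ∑ i, ∑ j, e.coord i ((sasakiMetric G h z).inverse
        (LinearMap.toContinuousLinearMap (e.coord j))) •
      secondFundamentalFormFst G (sasakiMetric G h) z (e i) (e j) = 0 :=
  sum_coord_inverse_smul_eq_zero e hSinv horizontalReflection_involutive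
    sasakiMetric_horizontalReflection
    (secondFundamentalFormFst_horizontalReflection hGinv hSinv hG hΓ hh hsymm hpar)

end SasakiMetric

section BergerFibreMetric

variable {V : Type*} [NormedAddCommGroup V] [NormedSpace ℝ V]

/-- The one-form `G(Φ u, ·)` on the fibre at the point with induced coordinates `(x, u)`. -/
def fibreForm (G : V → V →L[ℝ] V →L[ℝ] ℝ) (Φ : V → V →L[ℝ] V) (z : V × V) : V →L[ℝ] ℝ :=
  G z.1 (Φ z.1 z.2)

/-- The Berger type deformation `G + δ² θ ⊗ θ` of the metric on the fibre at the point with induced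
coordinates `(x, u)`, where `θ = G(Φ u, ·)`. -/
def bergerFibreMetric (G : V → V →L[ℝ] V →L[ℝ] ℝ) (Φ : V → V →L[ℝ] V) (δ : ℝ) (z : V × V) :
    V →L[ℝ] V →L[ℝ] ℝ :=
  G z.1 + δ ^ 2 • (ContinuousLinearMap.mul ℝ ℝ).bilinearComp (fibreForm G Φ z) (fibreForm G Φ z)

variable {G : V → V →L[ℝ] V →L[ℝ] ℝ} {Φ : V → V →L[ℝ] V} {δ : ℝ} {z : V × V}

lemma bergerFibreMetric_apply (k l : V) :
    bergerFibreMetric G Φ δ z k l = G z.1 k l + δ ^ 2 * (fibreForm G Φ z k * fibreForm G Φ z l) :=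
  rfl

lemma bergerFibreMetric_symm (hG : ∀ b c, G z.1 b c = G z.1 c b) (k l : V) :
    bergerFibreMetric G Φ δ z k l = bergerFibreMetric G Φ δ z l k := by
  rw [bergerFibreMetric_apply, bergerFibreMetric_apply, hG, mul_comm (fibreForm G Φ z k)]

lemma bergerFibreMetric_pos (hG : ∀ v, v ≠ 0 → 0 < G z.1 v v) (k : V) (hk : k ≠ 0) :
    0 < bergerFibreMetric G Φ δ z k k :=
  add_pos_of_pos_of_nonneg (hG k hk) (mul_nonneg (sq_nonneg δ) (mul_self_nonneg _))

lemma contDiffAt_fibreForm {n : WithTop ℕ∞} (hG : ContDiffAt ℝ n G z.1)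
    (hΦ : ContDiffAt ℝ n Φ z.1) : ContDiffAt ℝ n (fibreForm G Φ) z :=
  (hG.comp z contDiffAt_fst).clm_apply ((hΦ.comp z contDiffAt_fst).clm_apply contDiffAt_snd)

lemma contDiffAt_bergerFibreMetric {n : WithTop ℕ∞} (hG : ContDiffAt ℝ n G z.1)
    (hΦ : ContDiffAt ℝ n Φ z.1) : ContDiffAt ℝ n (bergerFibreMetric G Φ δ) z :=
  have hθ := contDiffAt_fibreForm hG hΦ
  (hG.comp z contDiffAt_fst).add
    ((contDiffAt_bilinearComp contDiffAt_const hθ hθ).const_smul (δ ^ 2))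

variable (hGinv : (G z.1).IsInvertible) (hG : DifferentiableAt ℝ G z.1)
  (hs : ∀ᶠ x in 𝓝 z.1, ∀ b c, G x b c = G x c b) (hΦ : DifferentiableAt ℝ Φ z.1)
  (hpar : ∀ a b, fderiv ℝ Φ z.1 a b + christoffel G z.1 a (Φ z.1 b) -
    Φ z.1 (christoffel G z.1 a b) = 0)

include hGinv hG hs hΦ hpar

lemma fderiv_fibreForm_horizontalLiftLocal (c k : V) :
    fderiv ℝ (fibreForm G Φ) z (horizontalLiftLocal G z c) k =
      fibreForm G Φ z (christoffel G z.1 c k) := by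
  have hfst : HasFDerivAt Prod.fst (ContinuousLinearMap.fst ℝ V V) z := hasFDerivAt_fst
  have hG₁ := hG.hasFDerivAt.comp z hfst
  have hΦ₁ := (hΦ.hasFDerivAt.comp z hfst).clm_apply hasFDerivAt_snd
  have hθ : HasFDerivAt (fibreForm G Φ) _ z := hG₁.clm_apply hΦ₁
  have hΦu : fderiv ℝ Φ z.1 c z.2 - Φ z.1 (christoffel G z.1 c z.2) =
      -christoffel G z.1 c (Φ z.1 z.2) := by
    rw [eq_neg_iff_add_eq_zero, ← hpar c z.2]
    abel
  calc fderiv ℝ (fibreForm G Φ) z (horizontalLiftLocal G z c) k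
      = fderiv ℝ G z.1 c (Φ z.1 z.2) k +
          G z.1 (fderiv ℝ Φ z.1 c z.2 - Φ z.1 (christoffel G z.1 c z.2)) k := by
        rw [hθ.fderiv]
        simp only [Function.comp_apply, ContinuousLinearMap.comp_add, horizontalLiftLocal,
          add_apply, ContinuousLinearMap.comp_apply, ContinuousLinearMap.coe_snd', map_neg,
          ContinuousLinearMap.flip_apply, ContinuousLinearMap.coe_fst', neg_apply, map_sub,
          sub_apply]
        ring
    _ = fibreForm G Φ z (christoffel G z.1 c k) := by
        rw [hΦu, fderiv_metric_eq hGinv hG hs, map_neg, neg_apply, fibreForm]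
        ring

lemma isHorizontallyParallelAt_bergerFibreMetric :
    IsHorizontallyParallelAt G (bergerFibreMetric G Φ δ) z := by
  intro c k l
  have hG₁ : DifferentiableAt ℝ (fun w : V × V => G w.1) z := hG.comp z differentiableAt_fst
  have hθ : DifferentiableAt ℝ (fibreForm G Φ) z :=
    hG₁.clm_apply ((hΦ.comp z differentiableAt_fst).clm_apply differentiableAt_snd)
  have hmul := differentiableAt_const (𝕜 := ℝ) (x := z) (ContinuousLinearMap.mul ℝ ℝ)
  have hθθ := differentiableAt_bilinearComp hmul hθ hθ
  have hδθθ : DifferentiableAt ℝ (fun w => δ ^ 2 • (ContinuousLinearMap.mul ℝ ℝ).bilinearComp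
      (fibreForm G Φ w) (fibreForm G Φ w)) z := hθθ.const_smul (δ ^ 2)
  have hderiv : fderiv ℝ (bergerFibreMetric G Φ δ) z (horizontalLiftLocal G z c) k l =
      fderiv ℝ G z.1 c k l +
        δ ^ 2 * (fderiv ℝ (fibreForm G Φ) z (horizontalLiftLocal G z c) k * fibreForm G Φ z l +
          fibreForm G Φ z k * fderiv ℝ (fibreForm G Φ) z (horizontalLiftLocal G z c) l) := by
    unfold bergerFibreMetric
    rw [fderiv_fun_add hG₁ hδθθ, fderiv_fun_const_smul hθθ,
      fderiv_fun_comp z hG differentiableAt_fst]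
    simp [fderiv_bilinearComp_apply hmul hθ hθ, fderiv_fst, horizontalLiftLocal]
  rw [hderiv, fderiv_fibreForm_horizontalLiftLocal hGinv hG hs hΦ hpar,
    fderiv_fibreForm_horizontalLiftLocal hGinv hG hs hΦ hpar, fderiv_metric_eq hGinv hG hs,
    bergerFibreMetric_apply, bergerFibreMetric_apply]
  ring

end BergerFibreMetric

section Charts

variable {E : Type*} [NormedAddCommGroup E] [NormedSpace ℝ E]
  {H : Type*} [TopologicalSpace H] (I : ModelWithCorners ℝ E H)
  {M : Type*} [TopologicalSpace M] [ChartedSpace H M]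

/-- The transition map from the preferred chart at `p` to the preferred chart at `q`. -/
def chartTransition (p q : M) (y : E) : E :=
  extChartAt I q ((extChartAt I p).symm y)

/-- The coordinate frame of the preferred chart at `p`, at the point with coordinates `y`: it maps
components in that chart to the tangent vector, which itself is encoded by its components in the
preferred chart at its base point. -/
def coordFrame (p : M) (y : E) : E →L[ℝ] E :=
  mfderiv 𝓘(ℝ, E) I (extChartAt I p).symm y

/-- The components in the preferred chart at `p` of the tangent vectors at `q`. -/
def coordCoframe (p q : M) : E →L[ℝ] E :=
  mfderiv I 𝓘(ℝ, E) (extChartAt I p) q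

lemma metricInChart_apply
    (h : ∀ q : M, TangentSpace I q →L[ℝ] TangentSpace I q →L[ℝ] ℝ) (p : M) (y b c : E) :
    metricInChart I h p y b c =
      (h ((extChartAt I p).symm y) : E →L[ℝ] E →L[ℝ] ℝ) (coordFrame I p y b)
        (coordFrame I p y c) := rfl

lemma secondFundamentalForm_apply {E' : Type*} [NormedAddCommGroup E'] [NormedSpace ℝ E']
    {H' : Type*} [TopologicalSpace H'] (I' : ModelWithCorners ℝ E' H')
    {N : Type*} [TopologicalSpace N] [ChartedSpace H' N]
    (h : ∀ q : M, TangentSpace I q →L[ℝ] TangentSpace I q →L[ℝ] ℝ)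
    (h' : ∀ q : N, TangentSpace I' q →L[ℝ] TangentSpace I' q →L[ℝ] ℝ) (f : M → N) (p : M)
    (a b : E) :
    secondFundamentalForm I I' h h' f p a b =
      fderiv ℝ (fderiv ℝ (writtenInExtChartAt I I' p f)) (extChartAt I p p) a b -
        fderiv ℝ (writtenInExtChartAt I I' p f) (extChartAt I p p)
          (christoffel (V := E) (metricInChart I h p) (extChartAt I p p) a b) +
        christoffel (V := E') (metricInChart I' h' (f p)) (extChartAt I' (f p) (f p))
          (fderiv ℝ (writtenInExtChartAt I I' p f) (extChartAt I p p) a)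
          (fderiv ℝ (writtenInExtChartAt I I' p f) (extChartAt I p p) b) :=
  rfl

variable {I} in
lemma extChartAt_symm_mem_chartAt_source {p : M} {y : E} (hy : y ∈ (extChartAt I p).target) :
    (extChartAt I p).symm y ∈ (chartAt H p).source := by
  rw [← extChartAt_source I]
  exact (extChartAt I p).map_target hy

variable [I.Boundaryless]

variable {I} in
lemma eventually_mem_target_and_symm_mem_source {p q : M} {y : E}
    (hy : y ∈ (extChartAt I p).target) (hq : (extChartAt I p).symm y ∈ (extChartAt I q).source) :
    ∀ᶠ z in 𝓝 y, z ∈ (extChartAt I p).target ∧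
      (extChartAt I p).symm z ∈ (extChartAt I q).source :=
  (show ∀ᶠ z in 𝓝 y, z ∈ (extChartAt I p).target from extChartAt_target_mem_nhds' hy).and
    ((continuousAt_extChartAt_symm'' hy).preimage_mem_nhds
      ((isOpen_extChartAt_source q).mem_nhds hq))

lemma contMDiffAt_iff_contDiffAt_comp_symm {F : Type*} [NormedAddCommGroup F] [NormedSpace ℝ F]
    {n : WithTop ℕ∞} [IsManifold I n M] {f : M → F} {p : M} :
    ContMDiffAt I 𝓘(ℝ, F) n f p ↔
      ContDiffAt ℝ n (fun y => f ((extChartAt I p).symm y)) (extChartAt I p p) := by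
  rw [contMDiffAt_iff_source, I.range_eq_univ, contMDiffWithinAt_univ, contMDiffAt_iff_contDiffAt]
  rfl

variable [IsManifold I ∞ M]

variable {I} in
lemma mdifferentiableAt_extChartAt_symm {p : M} {y : E} (hy : y ∈ (extChartAt I p).target) :
    MDifferentiableAt 𝓘(ℝ, E) I (extChartAt I p).symm y := by
  simpa only [I.range_eq_univ, mdifferentiableWithinAt_univ] using
    mdifferentiableWithinAt_extChartAt_symm (I := I) hy

lemma coordFrame_self (p : M) :
    coordFrame I p (extChartAt I p p) = ContinuousLinearMap.id ℝ E := by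
  rw [coordFrame, ← mfderivWithin_univ, ← I.range_eq_univ]
  exact mfderivWithin_range_extChartAt_symm

variable {I} in
lemma isInvertible_coordFrame {p : M} {y : E} (hy : y ∈ (extChartAt I p).target) :
    (coordFrame I p y).IsInvertible := by
  rw [coordFrame, ← mfderivWithin_univ, ← I.range_eq_univ]
  exact isInvertible_mfderivWithin_extChartAt_symm hy

lemma coordFrame_comp_coordCoframe {p : M} {y : E} (hy : y ∈ (extChartAt I p).target) :
    coordFrame I p y ∘L coordCoframe I p ((extChartAt I p).symm y) =
      ContinuousLinearMap.id ℝ E := by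
  rw [coordFrame, coordCoframe, ← mfderivWithin_univ, ← I.range_eq_univ]
  exact mfderivWithin_extChartAt_symm_comp_mfderiv_extChartAt hy

lemma symmL_trivializationAt_eq_coordFrame {p : M} {y : E} (hy : y ∈ (extChartAt I p).target) :
    (trivializationAt E (TangentSpace I) p).symmL ℝ ((extChartAt I p).symm y) =
      coordFrame I p y := by
  rw [TangentBundle.symmL_trivializationAt (extChartAt_symm_mem_chartAt_source hy),
    (extChartAt I p).right_inv hy, I.range_eq_univ, mfderivWithin_univ]
  rfl

lemma symm_trivializationAt_apply {p : M} {y : E} (hy : y ∈ (extChartAt I p).target) (a : E) :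
    (trivializationAt E (TangentSpace I) p).symm ((extChartAt I p).symm y) a =
      coordFrame I p y a :=
  (Bundle.Trivialization.symmL_apply (R := ℝ) _
    (extChartAt_symm_mem_chartAt_source hy) a).symm.trans
      (congrArg (fun L : E →L[ℝ] E => L a) (symmL_trivializationAt_eq_coordFrame I hy))

lemma contMDiffAt_metric_iff
    (h : ∀ q : M, TangentSpace I q →L[ℝ] TangentSpace I q →L[ℝ] ℝ) (p : M) :
    ContMDiffAt I (I.prod 𝓘(ℝ, E →L[ℝ] E →L[ℝ] ℝ)) ∞
      (fun q ↦ Bundle.TotalSpace.mk' (E →L[ℝ] E →L[ℝ] ℝ)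
        (E := fun q : M ↦ TangentSpace I q →L[ℝ] TangentSpace I q →L[ℝ] ℝ) q (h q)) p ↔
    ContDiffAt ℝ ∞ (metricInChart I h p) (extChartAt I p p) := by
  rw [contMDiffAt_hom_bundle, contMDiffAt_iff_contDiffAt_comp_symm]
  refine (and_iff_right contMDiffAt_id).trans ?_
  suffices hev : _ =ᶠ[𝓝 (extChartAt I p p)] metricInChart I h p from
    ⟨fun hf => hf.congr_of_eventuallyEq hev.symm, fun hf => hf.congr_of_eventuallyEq hev⟩
  filter_upwards [extChartAt_target_mem_nhds (I := I) p] with y hy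
  have hq := extChartAt_symm_mem_chartAt_source hy
  ext a b
  refine (inCoordinates_apply_eq₂ (E₁ := (TangentSpace I : M → Type _)) (F₁ := E)
    (E₂ := (TangentSpace I : M → Type _)) (F₂ := E) (E₃ := Bundle.Trivial M ℝ) (F₃ := ℝ)
    (ϕ := h ((extChartAt I p).symm y)) (v := a) (w := b) hq hq (Set.mem_univ _)).trans ?_
  rw [symm_trivializationAt_apply I hy, symm_trivializationAt_apply I hy]
  simp only [Bundle.Trivial.fiberBundle_trivializationAt',
    Bundle.Trivial.linearMapAt_trivialization, LinearMap.id_coe, id_eq]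
  rfl

lemma contDiffAt_endoInChart {φ : ∀ q : M, TangentSpace I q →L[ℝ] TangentSpace I q} {p : M}
    (hφ : ContMDiffAt I (I.prod 𝓘(ℝ, E →L[ℝ] E)) ∞
      (fun q ↦ Bundle.TotalSpace.mk' (E →L[ℝ] E)
        (E := fun q : M ↦ TangentSpace I q →L[ℝ] TangentSpace I q) q (φ q)) p) :
    ContDiffAt ℝ ∞ (endoInChart I φ p) (extChartAt I p p) := by
  rw [contMDiffAt_hom_bundle, contMDiffAt_iff_contDiffAt_comp_symm] at hφ
  refine hφ.2.congr_of_eventuallyEq ?_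
  filter_upwards [extChartAt_target_mem_nhds (I := I) p] with y hy
  have hchart := TangentBundle.continuousLinearMapAt_trivializationAt (𝕜 := ℝ) (I := I)
    (extChartAt_symm_mem_chartAt_source hy)
  have hframe := symmL_trivializationAt_eq_coordFrame I hy
  rw [coordFrame] at hframe
  rw [endoInChart, ← hframe, ← hchart]
  rfl

lemma contDiffAt_chartTransition {p q : M} {y : E} (hy : y ∈ (extChartAt I p).target)
    (hq : (extChartAt I p).symm y ∈ (extChartAt I q).source) :
    ContDiffAt ℝ ∞ (chartTransition I p q) y := by
  have hsymm : ContMDiffAt 𝓘(ℝ, E) I ∞ (extChartAt I p).symm y :=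
    (contMDiffOn_extChartAt_symm (I := I) (n := ∞) p).contMDiffAt (extChartAt_target_mem_nhds' hy)
  have hchart : ContMDiffAt I 𝓘(ℝ, E) ∞ (extChartAt I q) ((extChartAt I p).symm y) :=
    contMDiffAt_extChartAt' (by rwa [extChartAt_source] at hq)
  exact contMDiffAt_iff_contDiffAt.mp (hchart.comp y hsymm)

lemma fderiv_chartTransition {p q : M} {y : E} (hy : y ∈ (extChartAt I p).target)
    (hq : (extChartAt I p).symm y ∈ (extChartAt I q).source) :
    fderiv ℝ (chartTransition I p q) y =
      coordCoframe I q ((extChartAt I p).symm y) ∘L coordFrame I p y := by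
  rw [extChartAt_source] at hq
  have hcomp := mfderiv_comp y (mdifferentiableAt_extChartAt hq)
    (mdifferentiableAt_extChartAt_symm hy)
  rw [mfderiv_eq_fderiv] at hcomp
  exact hcomp

lemma coordFrame_eq_comp_fderiv_chartTransition {p q : M} {y : E}
    (hy : y ∈ (extChartAt I p).target) (hq : (extChartAt I p).symm y ∈ (extChartAt I q).source) :
    coordFrame I p y =
      coordFrame I q (chartTransition I p q y) ∘L fderiv ℝ (chartTransition I p q) y := by
  have hκ : chartTransition I p q y ∈ (extChartAt I q).target := (extChartAt I q).map_source hq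
  have hinv : (extChartAt I q).symm (chartTransition I p q y) = (extChartAt I p).symm y :=
    (extChartAt I q).left_inv hq
  rw [fderiv_chartTransition I hy hq, ← ContinuousLinearMap.comp_assoc, ← hinv,
    coordFrame_comp_coordCoframe I hκ, ContinuousLinearMap.id_comp]

lemma coordFrame_eq_fderiv_chartTransition {p : M} {y : E} (hy : y ∈ (extChartAt I p).target) :
    coordFrame I p y = fderiv ℝ (chartTransition I p ((extChartAt I p).symm y)) y := by
  rw [coordFrame_eq_comp_fderiv_chartTransition I hy (mem_extChartAt_source _), chartTransition,
    coordFrame_self, ContinuousLinearMap.id_comp]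

lemma metricInChart_eq_bilinearComp_fderiv_chartTransition
    (h : ∀ q : M, TangentSpace I q →L[ℝ] TangentSpace I q →L[ℝ] ℝ) {p q : M} {y : E}
    (hy : y ∈ (extChartAt I p).target) (hq : (extChartAt I p).symm y ∈ (extChartAt I q).source) :
    metricInChart I h p y = (metricInChart I h q (chartTransition I p q y)).bilinearComp
      (fderiv ℝ (chartTransition I p q) y) (fderiv ℝ (chartTransition I p q) y) := by
  have hinv : (extChartAt I q).symm (chartTransition I p q y) = (extChartAt I p).symm y :=
    (extChartAt I q).left_inv hq
  refine ContinuousLinearMap.ext fun b => ContinuousLinearMap.ext fun c => ?_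
  rw [ContinuousLinearMap.bilinearComp_apply, metricInChart_apply, metricInChart_apply, hinv,
    coordFrame_eq_comp_fderiv_chartTransition I hy hq]
  rfl

lemma metricInChart_self (h : ∀ q : M, TangentSpace I q →L[ℝ] TangentSpace I q →L[ℝ] ℝ) (p : M) :
    metricInChart I h p (extChartAt I p p) = h p := by
  refine ContinuousLinearMap.ext fun b => ContinuousLinearMap.ext fun c => ?_
  rw [metricInChart_apply, coordFrame_self,
    (extChartAt I p).left_inv (mem_extChartAt_source p)]
  rfl

variable (φ : ∀ q : M, TangentSpace I q →L[ℝ] TangentSpace I q)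

lemma coordFrame_endoInChart {p : M} {y : E} (hy : y ∈ (extChartAt I p).target) (u : E) :
    coordFrame I p y (endoInChart I φ p y u) =
      φ ((extChartAt I p).symm y) (coordFrame I p y u) :=
  congrArg (fun L : E →L[ℝ] E => L (φ ((extChartAt I p).symm y) (coordFrame I p y u)))
    (coordFrame_comp_coordCoframe I hy)

lemma endoInChart_self (p : M) : endoInChart I φ p (extChartAt I p p) = φ p := by
  ext u
  have hu := coordFrame_endoInChart I φ (mem_extChartAt_target (I := I) p) u
  rwa [coordFrame_self, (extChartAt I p).left_inv (mem_extChartAt_source p)] at hu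

end Charts

section TangentBundleCharts

variable {E : Type*} [NormedAddCommGroup E] [NormedSpace ℝ E]
  {H : Type*} [TopologicalSpace H] (I : ModelWithCorners ℝ E H)
  {M : Type*} [TopologicalSpace M] [ChartedSpace H M] [IsManifold I ∞ M]

variable {I} in
lemma mem_extChartAt_tangent_target_iff {v : TangentBundle I M} {z : E × E} :
    z ∈ (extChartAt I.tangent v).target ↔ z.1 ∈ (extChartAt I v.proj).target := by
  rw [FiberBundle.extChartAt_target]
  simp only [Set.mem_prod, Set.mem_univ, and_true, Set.mem_inter_iff, and_iff_left_iff_imp]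
  intro hz
  rw [Set.mem_preimage, TangentBundle.trivializationAt_baseSet]
  exact extChartAt_symm_mem_chartAt_source hz

lemma extChartAt_tangent_apply (w x : TangentBundle I M)
    (hx : x.proj ∈ (extChartAt I w.proj).source) :
    extChartAt I.tangent w x =
      (extChartAt I w.proj x.proj, coordCoframe I w.proj x.proj x.2) := by
  rw [extChartAt_source] at hx
  rw [coordCoframe, ← TangentBundle.continuousLinearMapAt_trivializationAt hx,
    FiberBundle.extChartAt]
  refine Prod.ext rfl ?_
  exact (congrFun (Bundle.Trivialization.coe_linearMapAt_of_mem (R := ℝ)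
    (trivializationAt E (TangentSpace I) w.proj) hx) x.2).symm

lemma extChartAt_tangent_self (v : TangentBundle I M) :
    extChartAt I.tangent v v = ((extChartAt I v.proj v.proj, v.2) : E × E) := by
  rw [extChartAt_tangent_apply I v v (mem_extChartAt_source _)]
  exact Prod.ext rfl (congrArg (fun L : E →L[ℝ] E => L v.2) mfderiv_extChartAt_self)

variable [I.Boundaryless]

lemma extChartAt_tangent_symm_apply (v : TangentBundle I M) {z : E × E}
    (hz : z.1 ∈ (extChartAt I v.proj).target) :
    (extChartAt I.tangent v).symm z =
      (⟨(extChartAt I v.proj).symm z.1, coordFrame I v.proj z.1 z.2⟩ : TangentBundle I M) := by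
  rw [← symm_trivializationAt_apply I hz, FiberBundle.extChartAt]
  exact (Bundle.Trivialization.mk_symm (trivializationAt E (TangentSpace I) v.proj)
    (extChartAt_symm_mem_chartAt_source hz) z.2).symm

lemma chartTransition_tangent (v w : TangentBundle I M) {z : E × E}
    (hz : z.1 ∈ (extChartAt I v.proj).target)
    (hw : (extChartAt I v.proj).symm z.1 ∈ (extChartAt I w.proj).source) :
    chartTransition I.tangent v w z = (chartTransition I v.proj w.proj z.1,
      fderiv ℝ (chartTransition I v.proj w.proj) z.1 z.2) := by
  rw [chartTransition, extChartAt_tangent_symm_apply I v hz, extChartAt_tangent_apply I w _ hw,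
    fderiv_chartTransition I hz hw]
  rfl

lemma fderiv_chartTransition_tangent (v w : TangentBundle I M) {z : E × E}
    (hz : z.1 ∈ (extChartAt I v.proj).target)
    (hw : (extChartAt I v.proj).symm z.1 ∈ (extChartAt I w.proj).source) (A : E × E) :
    fderiv ℝ (chartTransition I.tangent v w) z A =
      (fderiv ℝ (chartTransition I v.proj w.proj) z.1 A.1,
        fderiv ℝ (chartTransition I v.proj w.proj) z.1 A.2 +
          fderiv ℝ (fderiv ℝ (chartTransition I v.proj w.proj)) z.1 A.1 z.2) := by
  set κ : E → E := chartTransition I v.proj w.proj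
  have hκ : ContDiffAt ℝ ∞ κ z.1 := contDiffAt_chartTransition I hz hw
  have hev : chartTransition I.tangent v w =ᶠ[𝓝 z] fun x => (κ x.1, fderiv ℝ κ x.1 x.2) :=
    (continuousAt_fst.eventually (eventually_mem_target_and_symm_mem_source hz hw)).mono
      fun x hx => chartTransition_tangent I v w hx.1 hx.2
  have hfst : HasFDerivAt (fun x : E × E => κ x.1) _ z :=
    (hκ.differentiableAt (by simp)).hasFDerivAt.comp z hasFDerivAt_fst
  have hDfst : HasFDerivAt (fun x : E × E => fderiv ℝ κ x.1) _ z :=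
    ((hκ.fderiv_right (m := ∞) (by simp)).differentiableAt (by simp)).hasFDerivAt.comp z
      hasFDerivAt_fst
  rw [hev.fderiv_eq, (hfst.prodMk (hDfst.clm_apply hasFDerivAt_snd)).fderiv]
  simp

end TangentBundleCharts

section BergerSasakiInChart

variable {E : Type*} [NormedAddCommGroup E] [NormedSpace ℝ E]
  {H : Type*} [TopologicalSpace H] (I : ModelWithCorners ℝ E H)
  {M : Type*} [TopologicalSpace M] [ChartedSpace H M] [IsManifold I ∞ M]
  (g : Bundle.ContMDiffRiemannianMetric I ∞ E (TangentSpace I : M → Type _))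
  (φ : ∀ q : M, TangentSpace I q →L[ℝ] TangentSpace I q) (δ : ℝ)

/-- The Berger type deformed Sasaki metric in the chart of the tangent bundle induced by the
preferred chart at `p`. -/
abbrev bergerSasakiInChart (p : M) : E × E → E × E →L[ℝ] E × E →L[ℝ] ℝ :=
  sasakiMetric (metricInChart I g.inner p)
    (bergerFibreMetric (metricInChart I g.inner p) (endoInChart I φ p) δ)

lemma metricInChart_symm (p : M) (y b c : E) :
    metricInChart I g.inner p y b c = metricInChart I g.inner p y c b := by
  rw [metricInChart_apply, metricInChart_apply]
  exact g.symm _ _ _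

variable [I.Boundaryless]

lemma metricInChart_pos {p : M} {y : E} (hy : y ∈ (extChartAt I p).target) (b : E) (hb : b ≠ 0) :
    0 < metricInChart I g.inner p y b b := by
  rw [metricInChart_apply]
  exact g.pos _ _ fun h => hb ((isInvertible_coordFrame hy).injective (h.trans (map_zero _).symm))

lemma contDiffAt_metricInChart (p : M) :
    ContDiffAt ℝ ∞ (metricInChart I g.inner p) (extChartAt I p p) :=
  (contMDiffAt_metric_iff I g.inner p).mp g.contMDiff.contMDiffAt

lemma bergerSasakiInChart_pos (p : M) (u : E) (A : E × E) (hA : A ≠ 0) :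
    0 < bergerSasakiInChart I g φ δ p (extChartAt I p p, u) A A :=
  have hG := metricInChart_pos I g (mem_extChartAt_target p)
  sasakiMetric_pos hG (bergerFibreMetric_pos hG) A hA

lemma coordFrame_tangent_apply (v : TangentBundle I M) {z : E × E}
    (hz : z.1 ∈ (extChartAt I v.proj).target) (A : E × E) :
    coordFrame I.tangent v z A =
      (coordFrame I v.proj z.1 A.1, coordFrame I v.proj z.1 A.2 +
        fderiv ℝ (fderiv ℝ (chartTransition I v.proj ((extChartAt I v.proj).symm z.1)))
          z.1 A.1 z.2) := by
  rw [coordFrame_eq_fderiv_chartTransition I.tangent (mem_extChartAt_tangent_target_iff.2 hz),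
    extChartAt_tangent_symm_apply I v hz,
    fderiv_chartTransition_tangent I v _ hz (mem_extChartAt_source _),
    coordFrame_eq_fderiv_chartTransition I hz]

variable [FiniteDimensional ℝ E]

lemma coordFrame_christoffel {p : M} {y : E} (hy : y ∈ (extChartAt I p).target)
    (a b : E) :
    coordFrame I p y (christoffel (metricInChart I g.inner p) y a b) =
      fderiv ℝ (fderiv ℝ (chartTransition I p ((extChartAt I p).symm y))) y a b +
        christoffel (metricInChart I g.inner ((extChartAt I p).symm y))
          (extChartAt I ((extChartAt I p).symm y) ((extChartAt I p).symm y))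
          (coordFrame I p y a) (coordFrame I p y b) := by
  have hq := mem_extChartAt_source (I := I) ((extChartAt I p).symm y)
  have hsurj := (isInvertible_coordFrame hy).bijective.surjective
  rw [coordFrame_eq_fderiv_chartTransition I hy] at hsurj ⊢
  exact fderiv_apply_christoffel (isInvertible_of_pos (metricInChart_pos I g hy))
    (isInvertible_of_pos (metricInChart_pos I g (mem_extChartAt_target _)))
    ((contDiffAt_metricInChart I g _).differentiableAt (by simp))
    (metricInChart_symm I g _ _) ((contDiffAt_chartTransition I hy hq).of_le ENat.LEInfty.out) hsurj
    ((eventually_mem_target_and_symm_mem_source hy hq).mono fun z hz =>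
      metricInChart_eq_bilinearComp_fderiv_chartTransition I g.inner hz.1 hz.2) a b

lemma connectionMap_coordFrame_tangent (v : TangentBundle I M) {z : E × E}
    (hz : z.1 ∈ (extChartAt I v.proj).target) (A : E × E) :
    connectionMap I g.inner
        ⟨(extChartAt I v.proj).symm z.1, coordFrame I v.proj z.1 z.2⟩
        (coordFrame I.tangent v z A) =
      coordFrame I v.proj z.1 (connectionMapLocal (metricInChart I g.inner v.proj) z A) := by
  rw [connectionMapLocal_apply, map_add, coordFrame_christoffel I g hz, ← add_assoc,
    coordFrame_tangent_apply I v hz]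
  rfl

lemma metricInChart_bergerSasaki (v : TangentBundle I M) {z : E × E}
    (hz : z.1 ∈ (extChartAt I v.proj).target) :
    metricInChart I.tangent (bergerSasaki I g φ δ) v z =
      bergerSasakiInChart I g φ δ v.proj z := by
  have hfst (A : E × E) : (coordFrame I.tangent v z A).1 = coordFrame I v.proj z.1 A.1 := by
    rw [coordFrame_tangent_apply I v hz]
  refine ContinuousLinearMap.ext fun A => ContinuousLinearMap.ext fun B => ?_
  rw [metricInChart_apply, extChartAt_tangent_symm_apply I v hz]
  refine (bergerSasaki_apply I g φ δ _ _ _).trans ?_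
  rw [hfst, hfst, connectionMap_coordFrame_tangent I g v hz,
    connectionMap_coordFrame_tangent I g v hz, ← coordFrame_endoInChart I φ hz, add_assoc]
  rfl

lemma metricInChart_bergerSasaki_eventuallyEq (v : TangentBundle I M) :
    metricInChart I.tangent (bergerSasaki I g φ δ) v =ᶠ[𝓝 (extChartAt I.tangent v v)]
      bergerSasakiInChart I g φ δ v.proj := by
  rw [extChartAt_tangent_self]
  filter_upwards [continuousAt_fst.eventually (extChartAt_target_mem_nhds v.proj)] with z hz
  exact metricInChart_bergerSasaki I g φ δ v hz

lemma bergerSasaki_eq_bergerSasakiInChart (v : TangentBundle I M) :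
    (bergerSasaki I g φ δ v : E × E →L[ℝ] E × E →L[ℝ] ℝ) =
      bergerSasakiInChart I g φ δ v.proj (extChartAt I v.proj v.proj, v.2) := by
  rw [← extChartAt_tangent_self, ← (metricInChart_bergerSasaki_eventuallyEq I g φ δ v).eq_of_nhds]
  exact (metricInChart_self I.tangent _ v).symm

lemma contDiffAt_christoffel_metricInChart (p : M) :
    ContDiffAt ℝ ∞ (christoffel (metricInChart I g.inner p)) (extChartAt I p p) :=
  contDiffAt_christoffel (isInvertible_of_pos (metricInChart_pos I g (mem_extChartAt_target p)))
    (contDiffAt_metricInChart I g p) (by simp)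

variable {φ}

lemma contDiffAt_bergerSasakiInChart (p : M) (u : E)
    (hφ : ContDiffAt ℝ ∞ (endoInChart I φ p) (extChartAt I p p)) :
    ContDiffAt ℝ ∞ (bergerSasakiInChart I g φ δ p) (extChartAt I p p, u) :=
  have hG := contDiffAt_metricInChart I g p
  contDiffAt_sasakiMetric hG (contDiffAt_christoffel_metricInChart I g p)
    (contDiffAt_bergerFibreMetric hG hφ)

end BergerSasakiInChart

section Projection

open Bundle

variable {E : Type*} [NormedAddCommGroup E] [NormedSpace ℝ E]
  {H : Type*} [TopologicalSpace H] (I : ModelWithCorners ℝ E H)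
  {M : Type*} [TopologicalSpace M] [ChartedSpace H M] [IsManifold I ∞ M]
  (g : Bundle.ContMDiffRiemannianMetric I ∞ E (TangentSpace I : M → Type _))
  (φ : ∀ q : M, TangentSpace I q →L[ℝ] TangentSpace I q) (δ : ℝ)

lemma connectionMap_eq_zero_of_orthogonal (v : TangentBundle I M) (A : TangentSpace I.tangent v)
    (hA : ∀ C, mfderiv I.tangent I (TotalSpace.proj : TangentBundle I M → M) v C = 0 →
      bergerSasaki I g φ δ v A C = 0) :
    connectionMap I g.inner v A = 0 := by
  by_contra hne
  set k := connectionMap I g.inner v A with hk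
  have hvert := hA (verticalLift I v k) (mfderiv_proj_apply I v _)
  have hfst : g.inner v.proj (A : E × E).1 (verticalLift I v k : E × E).1 = 0 := map_zero _
  rw [bergerSasaki_apply, connectionMap_verticalLift, ← hk, hfst] at hvert
  have hθ := mul_nonneg (sq_nonneg δ) (mul_self_nonneg (g.inner v.proj (φ v.proj v.2) k))
  linarith [g.pos v.proj k hne]

lemma isRiemannianSubmersion_proj :
    IsRiemannianSubmersion I.tangent I (bergerSasaki I g φ δ) g.inner
      (TotalSpace.proj : TangentBundle I M → M) where
  contMDiff := contMDiff_proj (TangentSpace I : M → Type _)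
  surjective p := ⟨⟨p, 0⟩, rfl⟩
  surjective_mfderiv v X := ⟨((X, 0) : E × E), mfderiv_proj_apply I v _⟩
  isometric v A B hA hB := by
    have hzero (Z : TangentSpace I v.proj) : g.inner v.proj Z (0 : TangentSpace I v.proj) = 0 :=
      map_zero _
    rw [mfderiv_proj_apply, mfderiv_proj_apply, bergerSasaki_apply,
      connectionMap_eq_zero_of_orthogonal I g φ δ v A hA,
      connectionMap_eq_zero_of_orthogonal I g φ δ v B hB, hzero, hzero]
    ring

variable [I.Boundaryless]

lemma writtenInExtChartAt_proj_eventuallyEq (v : TangentBundle I M) :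
    writtenInExtChartAt I.tangent I v (TotalSpace.proj : TangentBundle I M → M)
      =ᶠ[𝓝 (extChartAt I.tangent v v)] (Prod.fst : E × E → E) := by
  rw [extChartAt_tangent_self]
  filter_upwards [continuousAt_fst.eventually (extChartAt_target_mem_nhds v.proj)] with z hz
  simp only [writtenInExtChartAt, Function.comp_apply, extChartAt_tangent_symm_apply I v hz]
  exact (extChartAt I v.proj).right_inv hz

lemma fderiv_writtenInExtChartAt_proj (v : TangentBundle I M) :
    fderiv ℝ (writtenInExtChartAt I.tangent I v (TotalSpace.proj : TangentBundle I M → M))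
      (extChartAt I.tangent v v) = ContinuousLinearMap.fst ℝ E E := by
  rw [(writtenInExtChartAt_proj_eventuallyEq I v).fderiv_eq, fderiv_fst]

lemma fderiv_fderiv_writtenInExtChartAt_proj (v : TangentBundle I M) :
    fderiv ℝ (fderiv ℝ
        (writtenInExtChartAt I.tangent I v (TotalSpace.proj : TangentBundle I M → M)))
      (extChartAt I.tangent v v) = 0 := by
  have hfst : fderiv ℝ (Prod.fst : E × E → E) = fun _ => ContinuousLinearMap.fst ℝ E E :=
    funext fun z => fderiv_fst
  rw [(writtenInExtChartAt_proj_eventuallyEq I v).fderiv.fderiv_eq, hfst, fderiv_const_apply]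

variable [FiniteDimensional ℝ E]

lemma secondFundamentalForm_proj (v : TangentBundle I M) (A B : E × E) :
    secondFundamentalForm I.tangent I (bergerSasaki I g φ δ) g.inner
        (TotalSpace.proj : TangentBundle I M → M) v A B =
      secondFundamentalFormFst (metricInChart I g.inner v.proj)
        (bergerSasakiInChart I g φ δ v.proj) (extChartAt I v.proj v.proj, v.2) A B := by
  refine (secondFundamentalForm_apply I.tangent I _ _ _ v A B).trans ?_
  rw [fderiv_fderiv_writtenInExtChartAt_proj, fderiv_writtenInExtChartAt_proj,
    christoffel_congr (metricInChart_bergerSasaki_eventuallyEq I g φ δ v), extChartAt_tangent_self,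
    secondFundamentalFormFst_apply, zero_apply, zero_apply, zero_sub, neg_add_eq_sub]
  rfl

lemma bergerSasaki_symm (v : TangentBundle I M) (A B : TangentSpace I.tangent v) :
    bergerSasaki I g φ δ v A B = bergerSasaki I g φ δ v B A := by
  have hG := metricInChart_symm I g v.proj (extChartAt I v.proj v.proj)
  rw [bergerSasaki_eq_bergerSasakiInChart]
  exact sasakiMetric_symm hG (bergerFibreMetric_symm hG) A B

lemma bergerSasaki_pos (v : TangentBundle I M) (A : TangentSpace I.tangent v) (hA : A ≠ 0) :
    0 < bergerSasaki I g φ δ v A A := by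
  rw [bergerSasaki_eq_bergerSasakiInChart]
  exact bergerSasakiInChart_pos I g φ δ v.proj v.2 A hA

variable {φ} (hφ : ContMDiff I (I.prod 𝓘(ℝ, E →L[ℝ] E)) ∞
  (fun q ↦ TotalSpace.mk' (E →L[ℝ] E) (E := fun q : M ↦ TangentSpace I q →L[ℝ] TangentSpace I q)
    q (φ q)))

/-- The Berger type deformed Sasaki metric as a smooth Riemannian metric on the tangent bundle. -/
def bergerSasakiMetric : Bundle.ContMDiffRiemannianMetric I.tangent ∞ (E × E)
    (TangentSpace I.tangent : TangentBundle I M → Type _) where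
  inner := bergerSasaki I g φ δ
  symm := bergerSasaki_symm I g φ δ
  pos := bergerSasaki_pos I g φ δ
  isVonNBounded v :=
    isVonNBounded_of_pos (V := E × E) (B := bergerSasaki I g φ δ v) (bergerSasaki_pos I g φ δ v)
  contMDiff v := by
    have hsmooth := contDiffAt_bergerSasakiInChart I g δ v.proj v.2
      (contDiffAt_endoInChart I hφ.contMDiffAt)
    rw [← extChartAt_tangent_self] at hsmooth
    exact (contMDiffAt_metric_iff _ _ _).2
      (hsmooth.congr_of_eventuallyEq (metricInChart_bergerSasaki_eventuallyEq I g φ δ v))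

variable (hpar : ∀ (q : M) (a b : TangentSpace I q), covDerivEndo I g.inner φ q a b = 0)

include hφ hpar

lemma isHorizontallyParallelAt_bergerFibreMetric_metricInChart (p : M) (u : E) :
    IsHorizontallyParallelAt (metricInChart I g.inner p)
      (bergerFibreMetric (metricInChart I g.inner p) (endoInChart I φ p) δ)
      (extChartAt I p p, u) := by
  refine isHorizontallyParallelAt_bergerFibreMetric
    (isInvertible_of_pos (metricInChart_pos I g (mem_extChartAt_target p)))
    ((contDiffAt_metricInChart I g p).differentiableAt (by simp))
    (Eventually.of_forall (metricInChart_symm I g p))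
    ((contDiffAt_endoInChart I hφ.contMDiffAt).differentiableAt (by simp)) fun a b => ?_
  rw [endoInChart_self]
  exact hpar p a b

lemma secondFundamentalFormFst_bergerSasakiInChart_eq_zero_iff (p : M) (u : E) :
    secondFundamentalFormFst (metricInChart I g.inner p) (bergerSasakiInChart I g φ δ p)
        (extChartAt I p p, u) = 0 ↔
      ∀ b c, curvatureLocal (metricInChart I g.inner p) (extChartAt I p p) b c u = 0 := by
  have hG := contDiffAt_metricInChart I g p
  have hpos := metricInChart_pos I g (mem_extChartAt_target p)
  have hfibre := contDiffAt_bergerFibreMetric (δ := δ) (z := (extChartAt I p p, u)) hG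
    (contDiffAt_endoInChart I hφ.contMDiffAt)
  exact secondFundamentalFormFst_eq_zero_iff (isInvertible_of_pos hpos)
    (isInvertible_of_pos (bergerSasakiInChart_pos I g φ δ p u)) (hG.differentiableAt (by simp))
    ((contDiffAt_christoffel_metricInChart I g p).differentiableAt (by simp))
    (hfibre.differentiableAt (by simp)) (bergerFibreMetric_symm (metricInChart_symm I g p _))
    (isHorizontallyParallelAt_bergerFibreMetric_metricInChart I g δ hφ hpar p u)
    (isInvertible_of_pos (bergerFibreMetric_pos hpos))

lemma sum_secondFundamentalFormFst_bergerSasakiInChart_eq_zero (p : M) (u : E) {ι : Type*}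
    [Fintype ι] (e : Module.Basis ι ℝ (E × E)) :
    ∑ i, ∑ j, e.coord i ((bergerSasakiInChart I g φ δ p (extChartAt I p p, u)).inverse
        (LinearMap.toContinuousLinearMap (e.coord j))) •
      secondFundamentalFormFst (metricInChart I g.inner p) (bergerSasakiInChart I g φ δ p)
        (extChartAt I p p, u) (e i) (e j) = 0 := by
  have hG := contDiffAt_metricInChart I g p
  have hpos := metricInChart_pos I g (mem_extChartAt_target p)
  have hfibre := contDiffAt_bergerFibreMetric (δ := δ) (z := (extChartAt I p p, u)) hG
    (contDiffAt_endoInChart I hφ.contMDiffAt)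
  exact sum_secondFundamentalFormFst_eq_zero (isInvertible_of_pos hpos)
    (isInvertible_of_pos (bergerSasakiInChart_pos I g φ δ p u)) (hG.differentiableAt (by simp))
    ((contDiffAt_christoffel_metricInChart I g p).differentiableAt (by simp))
    (hfibre.differentiableAt (by simp)) (bergerFibreMetric_symm (metricInChart_symm I g p _))
    (isHorizontallyParallelAt_bergerFibreMetric_metricInChart I g δ hφ hpar p u) e

lemma isTotallyGeodesic_proj_iff :
    IsTotallyGeodesic I.tangent I (bergerSasaki I g φ δ) g.inner
      (TotalSpace.proj : TangentBundle I M → M) ↔ IsLocallyFlat I g.inner := by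
  have hiff := secondFundamentalFormFst_bergerSasakiInChart_eq_zero_iff I g δ hφ hpar
  constructor
  · rintro ⟨-, hβ⟩ p b c u
    refine (hiff p u).1 (ContinuousLinearMap.ext fun A => ContinuousLinearMap.ext fun B => ?_) b c
    exact (secondFundamentalForm_proj I g φ δ (⟨p, u⟩ : TangentBundle I M) A B).symm.trans
      (hβ ⟨p, u⟩ A B)
  · refine fun hflat => ⟨contMDiff_proj (TangentSpace I : M → Type _), fun v A B => ?_⟩
    exact (secondFundamentalForm_proj I g φ δ v A B).trans (DFunLike.congr_fun
      (DFunLike.congr_fun ((hiff v.proj v.2).2 fun b c => hflat v.proj b c v.2) A) B)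

lemma isHarmonic_proj :
    IsHarmonic I.tangent I (bergerSasaki I g φ δ) g.inner
      (TotalSpace.proj : TangentBundle I M → M) := by
  refine ⟨contMDiff_proj (TangentSpace I : M → Type _), fun v => ?_⟩
  have htrace := sum_secondFundamentalFormFst_bergerSasakiInChart_eq_zero I g δ hφ hpar v.proj v.2
    (Module.finBasis ℝ (E × E))
  rw [← bergerSasaki_eq_bergerSasakiInChart] at htrace
  simp only [← secondFundamentalForm_proj] at htrace
  exact htrace

end Projection

end BergerSasaki

end

open BergerSasaki in
theorem mainTheorem1_general {E : Type*} [NormedAddCommGroup E] [NormedSpace ℝ E]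
    [FiniteDimensional ℝ E] {H : Type*} [TopologicalSpace H] (I : ModelWithCorners ℝ E H)
    [I.Boundaryless] {M : Type*} [TopologicalSpace M] [ChartedSpace H M] [IsManifold I ∞ M]
    (g : Bundle.ContMDiffRiemannianMetric I ∞ E (TangentSpace I : M → Type _))
    (φ : ∀ q : M, TangentSpace I q →L[ℝ] TangentSpace I q)
    (hφ : ContMDiff I (I.prod 𝓘(ℝ, E →L[ℝ] E)) ∞ (fun q ↦ Bundle.TotalSpace.mk' (E →L[ℝ] E)
      (E := fun q : M ↦ TangentSpace I q →L[ℝ] TangentSpace I q) q (φ q)))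
    (hpar : ∀ (q : M) (a b : TangentSpace I q), covDerivEndo I g.inner φ q a b = 0) (δ : ℝ) :
    ∃ gBS : Bundle.ContMDiffRiemannianMetric I.tangent ∞ (E × E)
        (TangentSpace I.tangent : TangentBundle I M → Type _),
      gBS.inner = bergerSasaki I g φ δ ∧
      IsRiemannianSubmersion I.tangent I gBS.inner g.inner
        (Bundle.TotalSpace.proj : TangentBundle I M → M) ∧
      (IsTotallyGeodesic I.tangent I gBS.inner g.inner
          (Bundle.TotalSpace.proj : TangentBundle I M → M) ↔
        IsLocallyFlat I g.inner) ∧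
      IsHarmonic I.tangent I gBS.inner g.inner
        (Bundle.TotalSpace.proj : TangentBundle I M → M) :=
  ⟨bergerSasakiMetric I g δ hφ, rfl, isRiemannianSubmersion_proj I g φ δ,
    isTotallyGeodesic_proj_iff I g δ hφ hpar, isHarmonic_proj I g δ hφ hpar⟩

theorem mainTheorem1 {E : Type*} [NormedAddCommGroup E] [NormedSpace ℝ E] [FiniteDimensional ℝ E]
    {M : Type*} [TopologicalSpace M] [ChartedSpace E M] [IsManifold 𝓘(ℝ, E) ∞ M]
    (g : Bundle.ContMDiffRiemannianMetric 𝓘(ℝ, E) ∞ E (TangentSpace 𝓘(ℝ, E) : M → Type _))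
    (φ : ∀ q : M, TangentSpace 𝓘(ℝ, E) q →L[ℝ] TangentSpace 𝓘(ℝ, E) q)
    (hφ : BergerSasaki.IsAntiParaKahler 𝓘(ℝ, E) g φ) (δ : ℝ) :
    ∃ gBS : Bundle.ContMDiffRiemannianMetric (𝓘(ℝ, E).tangent) ∞ (E × E)
        (TangentSpace 𝓘(ℝ, E).tangent : TangentBundle 𝓘(ℝ, E) M → Type _),
      gBS.inner = BergerSasaki.bergerSasaki 𝓘(ℝ, E) g φ δ ∧
      BergerSasaki.IsRiemannianSubmersion 𝓘(ℝ, E).tangent 𝓘(ℝ, E) gBS.inner g.inner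
        (Bundle.TotalSpace.proj : TangentBundle 𝓘(ℝ, E) M → M) ∧
      (BergerSasaki.IsTotallyGeodesic 𝓘(ℝ, E).tangent 𝓘(ℝ, E) gBS.inner g.inner
          (Bundle.TotalSpace.proj : TangentBundle 𝓘(ℝ, E) M → M) ↔
        BergerSasaki.IsLocallyFlat 𝓘(ℝ, E) g.inner) ∧
      BergerSasaki.IsHarmonic 𝓘(ℝ, E).tangent 𝓘(ℝ, E) gBS.inner g.inner
        (Bundle.TotalSpace.proj : TangentBundle 𝓘(ℝ, E) M → M) :=
  mainTheorem1_general 𝓘(ℝ, E) g φ hφ.contMDiff hφ.parallel δ
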